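/- Let $0<d<n$ with $n\in\mathbb N$ and $d$ real, $p=n/d$, $\frac1p+\frac1{p'}=1$, and $\epsilon>0$. Let $\Omega\subseteq\mathbb R^n$ be open and bounded, let $g:\Omega\times S^{n-1}\to\mathbb R$ be measurable and bounded, and let $K:\Omega\times\Omega\to[-\infty,\infty]$ be measurable with $$K(x,y)=g\Big(x,\frac{y-x}{|y-x|}\Big)|x-y|^{d-n}+O\big(|x-y|^{d-n+\epsilon}\big)$$ uniformly for $x,y\in\Omega$, $x\neq y$. Put $$A=\frac1n\sup_{x\in\Omega}\int_{S^{n-1}}|g(x,\omega)|^{p'}\,d\omega ,$$ where $d\omega$ is the surface measure, and assume $A>0$. Then for every real-valued $f\in L^p(\Omega)$ the integral $$Tf(x)=\int_\Omega K(x,y)f(y)\,dy$$ converges absolutely for a.e. $x\in\Omega$ and defines a measurable function, and there is a constant $C>0$, independent of $f$, such that $$\int_\Omega \exp\bigg[A^{-1}\bigg(\frac{|Tf(x)|}{\|f\|_p}\bigg)^{p'}\bigg]dx\le C\qquad\text{for all } f\in L^p(\Omega)$$ (the quotient being read as $0$ when $f=0$ a.e.). Suppose moreover that the supremum defining $A$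 is attained at some $x_0\in\Omega$ and that, for some $\sigma\in(0,1]$, there are constants $C',\delta>0$ with $|g(x,\omega)-g(x_0,\omega)|\le C'|x-x_0|^\sigma$ for all $x\in\Omega$ with $|x-x_0|\le\delta$ and all $\omega\in S^{n-1}$, and that $g(x_0,\cdot)$ is Hölder continuous of order $\sigma$ on $S^{n-1}$. Then the constant $A^{-1}$ is sharp: $$\sup_{f\in L^p(\Omega)}\int_\Omega \exp\bigg[\alpha\bigg(\frac{|Tf(x)|}{\|f\|_p}\bigg)^{p'}\bigg]dx=+\infty\qquad\text{for all }\alpha>A^{-1}.$$ More precisely, there is a sequence $r_m>0$, $r_m\to0$, with $B(x_0,r_m)\subseteq\Omega$ such that the functions $$\Phi_m(y)=K(x_0,y)\,|K(x_0,y)|^{p'-2}\,\chi_{\Omega\setminus B(x_0,r_m)}(y)$$ (read as $0$ where $K(x_0,y)=0$) belong to $L^p(\Omega)$ and $$\lim_{m\to\infty}\int_\Omega \exp\bigg[\alpha\bigg(\frac{|T\Phi_m(x)|}{\|\Phi_m\|_p}\bigg)^{p'}\bigg]dx=+\infty\qquad\text{for all }\alpha>A^{-1}.$$ -/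

import Mathlib

open MeasureTheory Set Filter Topology

noncomputable section

/-- `K(x,y) = g(x, (y-x)/|y-x|) |x-y|^{d-n} + O(|x-y|^{d-n+ε})`, uniformly for all `x ≠ y` in `Ω`.
The kernel may take the values `±∞`; the expansion forces it to be finite off the diagonal. -/
def HasKernelExpansion {n : ℕ} (Ω : Set (EuclideanSpace ℝ (Fin n)))
    (K : EuclideanSpace ℝ (Fin n) → EuclideanSpace ℝ (Fin n) → EReal)
    (g : EuclideanSpace ℝ (Fin n) → EuclideanSpace ℝ (Fin n) → ℝ) (d ε : ℝ) : Prop :=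
  ∃ C : ℝ, ∀ x ∈ Ω, ∀ y ∈ Ω, x ≠ y →
    (K x y - ((g x (‖y - x‖⁻¹ • (y - x)) * ‖x - y‖ ^ (d - n) : ℝ) : EReal)).abs
      ≤ ENNReal.ofReal (C * ‖x - y‖ ^ (d - n + ε))

/-- The spherical integral `∫_{S^{n-1}} |g(x,ω)|^q dω` with respect to surface measure. -/
def sphericalIntegral {n : ℕ}
    (g : EuclideanSpace ℝ (Fin n) → EuclideanSpace ℝ (Fin n) → ℝ) (q : ℝ)
    (x : EuclideanSpace ℝ (Fin n)) : ℝ :=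
  ∫ ω : Metric.sphere (0 : EuclideanSpace ℝ (Fin n)) 1, |g x ω| ^ q
    ∂(volume : Measure (EuclideanSpace ℝ (Fin n))).toSphere

/-- `A = (1/n) sup_{x ∈ Ω} ∫_{S^{n-1}} |g(x,ω)|^q dω`. -/
def adamsA {n : ℕ} (Ω : Set (EuclideanSpace ℝ (Fin n)))
    (g : EuclideanSpace ℝ (Fin n) → EuclideanSpace ℝ (Fin n) → ℝ) (q : ℝ) : ℝ :=
  (1 / (n : ℝ)) * sSup (sphericalIntegral g q '' Ω)

/-- `Tf(x) = ∫_Ω K(x,y) f(y) dy`. -/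
def potential {n : ℕ} (Ω : Set (EuclideanSpace ℝ (Fin n)))
    (K : EuclideanSpace ℝ (Fin n) → EuclideanSpace ℝ (Fin n) → EReal)
    (f : EuclideanSpace ℝ (Fin n) → ℝ) (x : EuclideanSpace ℝ (Fin n)) : ℝ :=
  ∫ y in Ω, (K x y).toReal * f y

/-- The norm of `f` in `L^p(Ω)`. -/
def lpNormOn {n : ℕ} (Ω : Set (EuclideanSpace ℝ (Fin n))) (p : ℝ)
    (f : EuclideanSpace ℝ (Fin n) → ℝ) : ℝ :=
  (eLpNorm f (ENNReal.ofReal p) (volume.restrict Ω)).toReal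

/-- `∫_Ω exp[α (|Tf(x)| / ‖f‖_p)^q] dx`, with values in `[0,∞]`. -/
def expIntegral {n : ℕ} (Ω : Set (EuclideanSpace ℝ (Fin n)))
    (K : EuclideanSpace ℝ (Fin n) → EuclideanSpace ℝ (Fin n) → EReal)
    (p q α : ℝ) (f : EuclideanSpace ℝ (Fin n) → ℝ) : ENNReal :=
  ∫⁻ x in Ω, ENNReal.ofReal (Real.exp (α * (|potential Ω K f x| / lpNormOn Ω p f) ^ q))

/-- `Φ(y) = K(x₀,y) |K(x₀,y)|^{q-2} χ_{Ω \ B(x₀,r)}(y)`. -/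
def truncatedKernel {n : ℕ} (Ω : Set (EuclideanSpace ℝ (Fin n)))
    (K : EuclideanSpace ℝ (Fin n) → EuclideanSpace ℝ (Fin n) → EReal)
    (q : ℝ) (x₀ : EuclideanSpace ℝ (Fin n)) (r : ℝ) : EuclideanSpace ℝ (Fin n) → ℝ :=
  (Ω \ Metric.ball x₀ r).indicator fun y => (K x₀ y).toReal * |(K x₀ y).toReal| ^ (q - 2)

end

open scoped ENNReal

/-! Write q for p'. The exponents are critical: (d - n)q = -n, so |K(x,·)|^q is |g|^q |x-y|^{-n} up
to an integrable error O(|x-y|^{ε-n}). Over an annulus r < |y-x| < R the main term integrates to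
(∫|g|^q dω) log(R/r) ≤ nA log(R/r), that is, to at most A times the logarithm of the ratio of
volumes. This is where A comes from (`HasKernelExpansion.isAdamsKernel`).

Upper bound. Let ‖f‖_p ≤ 1 and f ≥ 0. For each natural t take sets E_t, F_t of measure e^{-t}|Ω| on
which Tf, respectively f, is largest, and let h_t be the level of A⁻¹(Tf)^q on E_t. Split f along
F_t, apply Hölder off F_t and average over E_t: with l = ‖f‖_{L^p(F_t)}, (A h_t)^{1/q} ≤ (At +
C)^{1/q} (1 - l^p)^{1/p} + C l, together with a two-scale version for t' ≥ t. If h_t is close to t,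
Hölder is nearly an equality, so l is small, and too little of f is left for h_{t'} to be close to
t' much later. Hence {t : t - h_t ≤ λ} has O(λ) elements (`garsia_gap`), and ∑ e^{h_t - t}, which
dominates the exponential integral, is bounded (`tsum_exp_neg_le_of_gap`,
`IsAdamsKernel.lintegral_exp_le`).

Sharpness. Φ is extremal for Hölder at x₀: TΦ(x₀) = ‖Φ‖_p^p = I, with I ≥ nA log(1/r) - O(1). Hölder
continuity of g gives TΦ ≥ I - O(1) on B(x₀, r/2). There the exponent is at least αnA log(1/r) -
O(1), while the ball has volume of order r^n, so the integral diverges once αA > 1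
(`HasKernelExpansion.exists_truncatedKernel_bounds`, `tendsto_expIntegral_truncatedKernel`). -/

/-! ### One-variable inequalities: a discrete Garsia-type lemma. -/

/-- The set {a ≤ l} has O(l) elements: those below C₁l, and those in a window of length C₁l starting
at the first element beyond. Grouping the terms by the size of `a` leaves a convergent sum of (k +
1)e^{-k}. -/
theorem tsum_exp_neg_le_of_gap (C₀ C₁ : ℝ) (hC₁ : 0 ≤ C₁) :
    ∃ C : ℝ, 0 < C ∧ ∀ a : ℕ → ℝ, (∀ t, -C₀ ≤ a t) →
      (∀ l : ℝ, 1 ≤ l → ∀ t₁ t₂ : ℕ, a t₁ ≤ l → a t₂ ≤ l → t₁ ≤ t₂ → C₁ * l ≤ t₁ →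
        (t₂ : ℝ) - t₁ ≤ C₁ * l) →
      ∑' t, ENNReal.ofReal (Real.exp (-a t)) ≤ ENNReal.ofReal C := by
  set b : ℕ → ℝ := fun k => Real.exp (|C₀| + 1) * Real.exp (-(k : ℝ)) * (2 * C₁ * (k + 1) + 4)
    with hb
  have hbs : Summable b := by
    have h1 : Summable fun k : ℕ => Real.exp (-(k : ℝ)) := Real.summable_exp_neg_nat
    have h2 : Summable fun k : ℕ => (k : ℝ) * Real.exp (-(k : ℝ)) := by
      simpa using Real.summable_pow_mul_exp_neg_nat_mul 1 (r := 1) one_pos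
    have := ((h1.mul_left (2 * C₁ + 4)).add (h2.mul_left (2 * C₁))).mul_left (Real.exp (|C₀| + 1))
    refine this.congr fun k => ?_
    simp only [hb]; ring
  have hb0 : ∀ k, 0 ≤ b k := fun k => by simp only [hb]; positivity
  refine ⟨∑' k, b k + 1, add_pos_of_nonneg_of_pos (tsum_nonneg hb0) one_pos, fun a h0 h1 => ?_⟩
  calc ∑' t, ENNReal.ofReal (Real.exp (-a t))
      ≤ ∑' t, ∑' k : ℕ, (if a t ≤ k + 1 then
          ENNReal.ofReal (Real.exp (|C₀| + 1) * Real.exp (-(k : ℝ))) else 0) := by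
        refine ENNReal.tsum_le_tsum fun t => ?_
        have key : ∃ k : ℕ, a t ≤ k + 1 ∧ Real.exp (-a t) ≤
            Real.exp (|C₀| + 1) * Real.exp (-(k : ℝ)) := by
          -- The natural floor is 0 when `a t` is negative; the factor exp |C₀| pays for that case.
          refine ⟨⌊a t⌋₊, (Nat.lt_floor_add_one _).le, ?_⟩
          rw [← Real.exp_add, Real.exp_le_exp]
          rcases le_total 0 (a t) with h | h
          · have := Nat.floor_le h
            have := abs_nonneg C₀
            linarith
          · rw [Nat.floor_of_nonpos h]
            have := h0 t
            have := le_abs_self C₀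
            push_cast
            linarith
        obtain ⟨k, hk, hk'⟩ := key
        refine le_trans ?_ (ENNReal.le_tsum k)
        rw [if_pos hk]
        exact ENNReal.ofReal_le_ofReal hk'
    _ = ∑' k : ℕ, ∑' t, (if a t ≤ k + 1 then
          ENNReal.ofReal (Real.exp (|C₀| + 1) * Real.exp (-(k : ℝ))) else 0) := ENNReal.tsum_comm
    _ ≤ ∑' k : ℕ, ENNReal.ofReal (b k) := by
        refine ENNReal.tsum_le_tsum fun k => ?_
        have hl : (1 : ℝ) ≤ k + 1 := by simp
        have : ∃ s : Finset ℕ, (s.card : ℝ) ≤ 2 * C₁ * (k + 1) + 4 ∧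
            ∀ t, a t ≤ k + 1 → t ∈ s := by
          set m := ⌊C₁ * ((k : ℝ) + 1)⌋₊ with hm
          have hmm : (m : ℝ) ≤ C₁ * (k + 1) := Nat.floor_le (by positivity)
          by_cases hex : ∃ t, a t ≤ k + 1 ∧ C₁ * (k + 1) ≤ t
          · classical
            have hf := Nat.find_spec hex
            set t₁ := Nat.find hex
            refine ⟨Finset.range (m + 1) ∪ Finset.Icc t₁ (t₁ + m), ?_, fun t ht => ?_⟩
            · have := Finset.card_union_le (Finset.range (m + 1)) (Finset.Icc t₁ (t₁ + m))
              rw [Finset.card_range, Nat.card_Icc] at this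
              have : (Finset.range (m + 1) ∪ Finset.Icc t₁ (t₁ + m)).card ≤ 2 * m + 2 := by omega
              have : ((Finset.range (m + 1) ∪ Finset.Icc t₁ (t₁ + m)).card : ℝ) ≤ 2 * m + 2 := by
                exact_mod_cast this
              linarith
            · rw [Finset.mem_union, Finset.mem_range, Finset.mem_Icc]
              by_cases hc : C₁ * ((k : ℝ) + 1) ≤ t
              · right
                have h2 : t₁ ≤ t := Nat.find_min' hex ⟨ht, hc⟩
                refine ⟨h2, ?_⟩
                have := h1 _ hl t₁ t hf.1 ht h2 hf.2
                have h3 : t - t₁ ≤ m := Nat.le_floor (by rw [Nat.cast_sub h2]; exact this)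
                omega
              · left
                push Not at hc
                have : t ≤ m := Nat.le_floor hc.le
                omega
          · push Not at hex
            refine ⟨Finset.range (m + 1), ?_, fun t ht => ?_⟩
            · rw [Finset.card_range]; push_cast
              have : 0 ≤ C₁ * ((k : ℝ) + 1) := by positivity
              linarith
            · have : t ≤ m := Nat.le_floor (hex t ht).le
              rw [Finset.mem_range]; omega
        obtain ⟨s, hs, hs'⟩ := this
        rw [tsum_eq_sum (s := s) (fun t ht => if_neg fun h => ht (hs' t h))]
        refine (Finset.sum_le_sum (g := fun _ => ENNReal.ofReal
          (Real.exp (|C₀| + 1) * Real.exp (-(k : ℝ)))) fun t _ => ?_).trans ?_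
        · split_ifs <;> simp
        · rw [Finset.sum_const, nsmul_eq_mul, ← ENNReal.ofReal_natCast,
            ← ENNReal.ofReal_mul (by positivity)]
          refine ENNReal.ofReal_le_ofReal ?_
          simp only [hb]
          rw [mul_comm]
          gcongr
    _ ≤ ENNReal.ofReal (∑' k, b k + 1) := by
        rw [← ENNReal.ofReal_tsum_of_nonneg hb0 hbs]
        exact ENNReal.ofReal_le_ofReal (by linarith)

/-- Two-term Hölder inequality against a point of the unit sphere of `ℓ^p`. -/
theorem mul_rpow_one_sub_add_mul_le {p q : ℝ} (hpq : p.HolderConjugate q) {T c l : ℝ}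
    (hT : 0 ≤ T) (hc : 0 ≤ c) (hl : 0 ≤ l) (hl1 : l ≤ 1) :
    T ^ (1 / q) * (1 - l ^ p) ^ (1 / p) + c * l ≤ (T + c ^ q) ^ (1 / q) := by
  have hp := hpq.pos
  have hq := hpq.symm.pos
  have hlp : l ^ p ≤ 1 := Real.rpow_le_one hl hl1 hp.le
  have := Real.inner_le_Lp_mul_Lq_of_nonneg (Finset.univ : Finset (Fin 2))
    (f := ![(1 - l ^ p) ^ (1 / p), l]) (g := ![T ^ (1 / q), c]) hpq
    (by intro i _; fin_cases i
        · exact Real.rpow_nonneg (by linarith) _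
        · exact hl)
    (by intro i _; fin_cases i
        · exact Real.rpow_nonneg hT _
        · exact hc)
  simp only [Fin.sum_univ_two, Matrix.cons_val_zero, Matrix.cons_val_one] at this
  rw [← Real.rpow_mul (by linarith : 0 ≤ 1 - l ^ p), ← Real.rpow_mul hT,
    one_div_mul_cancel hp.ne', one_div_mul_cancel hq.ne', Real.rpow_one, Real.rpow_one,
    sub_add_cancel, Real.one_rpow, one_mul] at this
  linarith

/-- A self-improving bound: `r v^p ≤ κ + C v` forces `v^p ≲ κ`. -/
theorem rpow_le_of_mul_rpow_le_add {p r C : ℝ} (hp : 1 < p) (hr : 0 < r) (hC : 0 < C) :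
    ∃ C' : ℝ, 0 < C' ∧ ∀ κ v : ℝ, 1 ≤ κ → 0 ≤ v → r * v ^ p ≤ κ + C * v → v ^ p ≤ C' * κ := by
  -- `V` solves r V^p = 2 C V: above it the linear term is absorbed by half of the left side, below
  -- it v^p ≤ V^p ≤ V^p κ.
  set V := (2 * C / r) ^ (1 / (p - 1)) with hV
  have hp1 : 0 < p - 1 := by linarith
  have hV0 : 0 < V := by positivity
  refine ⟨2 / r + V ^ p, by positivity, fun κ v hκ hv h => ?_⟩
  have hV2 : 0 ≤ V ^ p := by positivity
  rcases le_total v V with hle | hle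
  · have h1 : v ^ p ≤ V ^ p := Real.rpow_le_rpow hv hle (by linarith)
    have h2 : 0 ≤ 2 / r * κ := by positivity
    nlinarith
  · have h1 : 2 * C / r ≤ v ^ (p - 1) := by
      calc 2 * C / r = V ^ (p - 1) := by
            rw [hV, ← Real.rpow_mul (by positivity), one_div_mul_cancel hp1.ne', Real.rpow_one]
        _ ≤ _ := Real.rpow_le_rpow hV0.le hle hp1.le
    have hv0 : 0 < v := hV0.trans_le hle
    have h2 : v ^ p = v ^ (p - 1) * v := by
      rw [← Real.rpow_add_one hv0.ne', sub_add_cancel]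
    have h3 : 2 * (C * v) ≤ r * v ^ p := by
      rw [div_le_iff₀ hr] at h1
      rw [h2]; nlinarith
    have h4 : v ^ p ≤ 2 / r * κ := by
      rw [div_mul_eq_mul_div, le_div_iff₀ hr]; linarith
    nlinarith

-- In the application l is the L^p norm of f on F_t. A deficit t₁ - h(t₁) ≤ λ makes Hölder nearly
-- sharp and forces l^p ≲ λ/t₁. With so small an l, the two-scale inequality cannot bring h up to t₂
-- - λ if t₂ - t₁ is much larger than λ.
set_option maxHeartbeats 400000 in
theorem garsia_gap_of_one_le {p q : ℝ} (hpq : p.HolderConjugate q) {C : ℝ} (hC : 1 ≤ C) :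
    ∃ C₀ C₁ : ℝ, 0 ≤ C₁ ∧ ∀ h : ℕ → ℝ, (∀ t, 0 ≤ h t) →
      (∀ t : ℕ, ∃ l : ℝ, 0 ≤ l ∧ l ≤ 1 ∧
        h t ^ (1 / q) ≤ (t + C) ^ (1 / q) * (1 - l ^ p) ^ (1 / p) + C * l ∧
        ∀ t' : ℕ, t ≤ t' → h t' ^ (1 / q) ≤
          (t + C) ^ (1 / q) + ((t' : ℝ) - t + C) ^ (1 / q) * l + C * l) →
      (∀ t : ℕ, -C₀ ≤ t - h t) ∧
      (∀ l : ℝ, 1 ≤ l → ∀ t₁ t₂ : ℕ, t₁ - h t₁ ≤ l → t₂ - h t₂ ≤ l → t₁ ≤ t₂ →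
        C₁ * l ≤ t₁ → (t₂ : ℝ) - t₁ ≤ C₁ * l) := by
  have hp := hpq.pos
  have hp1 := hpq.lt
  have hq := hpq.symm.pos
  have hq1 := hpq.symm.lt
  set s := 1 / q with hs
  set r := 1 / p with hr
  have hs0 : 0 < s := by positivity
  have hr0 : 0 < r := by positivity
  have hrs : r + s = 1 := by have := hpq.inv_add_inv_eq_one; simp [hr, hs, this]
  obtain ⟨C₅, hC₅, H₅⟩ := rpow_le_of_mul_rpow_le_add hp1 hr0 (by linarith : 0 < C)
  set C₆ := 1 + 2 * C with hC₆
  set C₇ := (2 * C₆ / s) ^ p * C₅ with hC₇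
  have hC₇0 : 0 < C₇ := by positivity
  refine ⟨C + C ^ q, (1 + C) * (2 * C₇ + 2), by positivity, fun h h0 H => ⟨fun t => ?_, ?_⟩⟩
  · obtain ⟨l, hl0, hl1, hle, -⟩ := H t
    have h1 := hle.trans (mul_rpow_one_sub_add_mul_le hpq (by positivity) (by linarith) hl0 hl1)
    rw [Real.rpow_le_rpow_iff (h0 t) (by positivity) (by positivity)] at h1
    linarith
  · intro lam hlam t₁ t₂ ht₁ ht₂ h12 hbig
    obtain ⟨l, hl0, hl1, hle, hle2⟩ := H t₁
    have hle2 := hle2 t₂ h12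
    set T := (t₁ : ℝ) + C with hT
    set κ := lam + C with hκ
    set D := (t₂ : ℝ) - t₁ with hD
    have hκ1 : κ ≤ (1 + C) * lam := by
      have := mul_le_mul_of_nonneg_left hlam (by linarith : 0 ≤ C)
      rw [hκ]
      linarith
    have hκ1' : 1 ≤ κ := by linarith
    have hκ2 : (2 * C₇ + 2) * κ ≤ (1 + C) * (2 * C₇ + 2) * lam := by
      calc (2 * C₇ + 2) * κ ≤ (2 * C₇ + 2) * ((1 + C) * lam) := by gcongr
        _ = _ := by ring
    have hC₇κ : 0 ≤ C₇ * κ := by positivity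
    have hT0 : 0 < T := by positivity
    have hκT : κ ≤ T := by linarith
    have hC₇T : C₇ * κ ≤ T := by linarith
    suffices hD' : D ≤ (2 * C₇ + 2) * κ from hD'.trans hκ2
    -- The quantity to control is v^p = l^p T. Multiplying the first inequality by T^r and using
    -- Bernoulli on (1 - l^p)^r gives r v^p ≤ κ + C v.
    set v := l * T ^ r with hv
    have hTr : 0 < T ^ r := Real.rpow_pos_of_pos hT0 _
    have hTrs : T ^ r * T ^ s = T := by rw [← Real.rpow_add hT0, hrs, Real.rpow_one]
    have hv0 : 0 ≤ v := by positivity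
    have hvp : v ^ p = l ^ p * T := by
      rw [hv, Real.mul_rpow hl0 hTr.le, ← Real.rpow_mul hT0.le, hr, one_div_mul_cancel hp.ne',
        Real.rpow_one]
    have hlp : l ^ p ≤ 1 := Real.rpow_le_one hl0 hl1 hp.le
    have hlp0 : 0 ≤ l ^ p := Real.rpow_nonneg hl0 _
    have hvκ : v ^ p ≤ C₅ * κ := by
      refine H₅ κ v hκ1' hv0 ?_
      have e1 : T - κ ≤ T ^ r * h t₁ ^ s := by
        have e2 : T - κ ≤ h t₁ := by rw [hT, hκ]; linarith
        calc T - κ = (T - κ) ^ r * (T - κ) ^ s := by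
              rw [← Real.rpow_add_of_nonneg (by linarith) hr0.le hs0.le, hrs, Real.rpow_one]
          _ ≤ T ^ r * h t₁ ^ s := by
              gcongr
              linarith
      have e3 : (1 - l ^ p) ^ r ≤ 1 - r * l ^ p := by
        have := rpow_one_add_le_one_add_mul_self (s := -l ^ p) (by linarith) hr0.le
          (by linarith)
        rw [← sub_eq_add_neg] at this
        linarith
      have e4 : T ^ r * h t₁ ^ s ≤ T * (1 - r * l ^ p) + C * v := by
        calc T ^ r * h t₁ ^ s ≤ T ^ r * (T ^ s * (1 - l ^ p) ^ r + C * l) := by gcongr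
          _ = (T ^ r * T ^ s) * (1 - l ^ p) ^ r + C * v := by rw [hv]; ring
          _ ≤ _ := by rw [hTrs]; gcongr
      rw [hvp]
      linarith
    by_cases hDκ : D ≤ 2 * κ
    · linarith
    push Not at hDκ
    have hD1 : 1 ≤ D := by linarith
    have hD0 : 0 < D := by linarith
    -- Once D > 2κ, h(t₂) ≥ t₂ - λ = T + D - κ ≥ z.
    set z := T + D / 2 with hz
    have hz0 : 0 < z := by positivity
    have f1 : z ^ s ≤ T ^ s + C₆ * D ^ s * l := by
      have g1 : z ≤ h t₂ := by rw [hz, hT]; linarith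
      have g2 : 1 ≤ D ^ s := Real.one_le_rpow hD1 hs0.le
      have g4 : D + C ≤ (1 + C) * D := by
        have := mul_nonneg (by linarith : 0 ≤ C) (by linarith : 0 ≤ D - 1)
        linarith
      have g5 : C ≤ C * D ^ s := le_mul_of_one_le_right (by linarith) g2
      have g3 : (D + C) ^ s ≤ (1 + C) * D ^ s := by
        calc (D + C) ^ s ≤ ((1 + C) * D) ^ s := by gcongr
          _ = (1 + C) ^ s * D ^ s := Real.mul_rpow (by linarith) hD0.le
          _ ≤ (1 + C) * D ^ s := by
            gcongr
            exact Real.rpow_le_self_of_one_le (by linarith) (by linarith)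
      calc z ^ s ≤ h t₂ ^ s := by gcongr
        _ ≤ T ^ s + (D + C) ^ s * l + C * l := hle2
        _ ≤ T ^ s + ((1 + C) * D ^ s) * l + (C * D ^ s) * l := by
          gcongr
        _ = _ := by rw [hC₆]; ring
    have f2 : z ≤ T ^ s * z ^ r + C₆ * D ^ s * l * z ^ r := by
      calc z = z ^ s * z ^ r := by rw [← Real.rpow_add hz0, add_comm, hrs, Real.rpow_one]
        _ ≤ (T ^ s + C₆ * D ^ s * l) * z ^ r := by gcongr
        _ = _ := by ring
    -- Young's inequality: subtracting it from z = s z + r z leaves s(z - T) = sD/2, so the main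
    -- terms cancel exactly.
    have f3 : T ^ s * z ^ r ≤ s * T + r * z :=
      Real.geom_mean_le_arith_mean2_weighted hs0.le hr0.le hT0.le hz0.le (by linarith)
    have f4 : s * (D / 2) ≤ C₆ * D ^ s * l * z ^ r := by
      have : s * z + r * z = z := by rw [← add_mul, add_comm s, hrs, one_mul]
      have : s * z = s * T + s * (D / 2) := by rw [hz]; ring
      linarith
    have f5 : D ^ r ≤ 2 * C₆ / s * (l * z ^ r) := by
      have hDs : 0 < D ^ s := by positivity
      have : D = D ^ s * D ^ r := by rw [← Real.rpow_add hD0, add_comm, hrs, Real.rpow_one]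
      have f6 : D ^ s * (s * D ^ r) ≤ D ^ s * (2 * C₆ * (l * z ^ r)) := by
        calc D ^ s * (s * D ^ r) = s * D := by rw [mul_left_comm, ← this]
          _ ≤ 2 * (C₆ * D ^ s * l * z ^ r) := by linarith
          _ = _ := by ring
      have f7 := le_of_mul_le_mul_left f6 hDs
      rw [div_mul_eq_mul_div, le_div_iff₀ hs0]
      linarith
    have f8 : D ≤ (2 * C₆ / s) ^ p * (l ^ p * z) := by
      have := Real.rpow_le_rpow (by positivity) f5 hp.le
      rwa [← Real.rpow_mul hD0.le, hr, one_div_mul_cancel hp.ne', Real.rpow_one,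
        Real.mul_rpow (by positivity) (by positivity), Real.mul_rpow hl0 (by positivity),
        ← Real.rpow_mul hz0.le, one_div_mul_cancel hp.ne', Real.rpow_one] at this
    have f9 : D * T ≤ C₇ * κ * z := by
      calc D * T ≤ (2 * C₆ / s) ^ p * (l ^ p * z) * T := by gcongr
        _ = (2 * C₆ / s) ^ p * (v ^ p) * z := by rw [hvp]; ring
        _ ≤ (2 * C₆ / s) ^ p * (C₅ * κ) * z := by gcongr
        _ = _ := by rw [hC₇]; ring
    -- The condition that t₁ is at least a multiple of λ enters here: C₇κ ≤ T lets half of D T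
    -- absorb the D/2 contained in z.
    have f10 : C₇ * κ * z ≤ C₇ * κ * T + T * (D / 2) := by
      have := mul_le_mul_of_nonneg_right hC₇T (by linarith : 0 ≤ D / 2)
      rw [hz, mul_add]
      linarith
    have : D * T ≤ (2 * C₇ * κ) * T := by linarith
    have := le_of_mul_le_mul_right this hT0
    linarith

/-- Dividing by A^{1/q} reduces to A = 1; the new constant must dominate 1, C/A and C/A^{1/q}. -/
theorem garsia_gap {p q : ℝ} (hpq : p.HolderConjugate q) {A C : ℝ} (hA : 0 < A) (hC : 0 ≤ C) :
    ∃ C₀ C₁ : ℝ, 0 ≤ C₁ ∧ ∀ h : ℕ → ℝ, (∀ t, 0 ≤ h t) →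
      (∀ t : ℕ, ∃ l : ℝ, 0 ≤ l ∧ l ≤ 1 ∧
        (A * h t) ^ (1 / q) ≤ (A * t + C) ^ (1 / q) * (1 - l ^ p) ^ (1 / p) + C * l ∧
        ∀ t' : ℕ, t ≤ t' → (A * h t') ^ (1 / q) ≤
          (A * t + C) ^ (1 / q) + (A * ((t' : ℝ) - t) + C) ^ (1 / q) * l + C * l) →
      (∀ t : ℕ, -C₀ ≤ t - h t) ∧
      (∀ l : ℝ, 1 ≤ l → ∀ t₁ t₂ : ℕ, t₁ - h t₁ ≤ l → t₂ - h t₂ ≤ l → t₁ ≤ t₂ →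
        C₁ * l ≤ t₁ → (t₂ : ℝ) - t₁ ≤ C₁ * l) := by
  have hp := hpq.pos
  have hq := hpq.symm.pos
  have hAq : 0 < A ^ (1 / q) := by positivity
  set C' := 1 + C / A + C / A ^ (1 / q) with hC'
  have hc1 : C ≤ A * C' := by
    have : A * C' = A + C + A * (C / A ^ (1 / q)) := by rw [hC']; field_simp
    have : 0 ≤ A * (C / A ^ (1 / q)) := by positivity
    linarith
  have hc2 : C ≤ A ^ (1 / q) * C' := by
    have : A ^ (1 / q) * C' = A ^ (1 / q) + A ^ (1 / q) * (C / A) + C := by rw [hC']; field_simp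
    have : 0 ≤ A ^ (1 / q) * (C / A) := by positivity
    linarith
  have hc3 : 1 ≤ C' := by
    have : 0 ≤ C / A + C / A ^ (1 / q) := by positivity
    linarith
  obtain ⟨C₀, C₁, hC₁, H⟩ := garsia_gap_of_one_le hpq hc3
  refine ⟨C₀, C₁, hC₁, fun h h0 hh => H h h0 fun t => ?_⟩
  obtain ⟨l, hl0, hl1, h1, h2⟩ := hh t
  have hlp : 0 ≤ 1 - l ^ p := by linarith [Real.rpow_le_one hl0 hl1 hp.le]
  have key : ∀ x : ℝ, 0 ≤ x → (A * x + C) ^ (1 / q) ≤ A ^ (1 / q) * (x + C') ^ (1 / q) := by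
    intro x hx
    rw [← Real.mul_rpow hA.le (by linarith)]
    gcongr
    linarith
  refine ⟨l, hl0, hl1, ?_, fun t' ht' => ?_⟩
  · refine le_of_mul_le_mul_left ?_ hAq
    rw [← Real.mul_rpow hA.le (h0 t)]
    calc _ ≤ _ := h1
      _ ≤ A ^ (1 / q) * (t + C') ^ (1 / q) * (1 - l ^ p) ^ (1 / p) + A ^ (1 / q) * C' * l := by
        gcongr
        exact key _ (by positivity)
      _ = _ := by ring
  · refine le_of_mul_le_mul_left ?_ hAq
    rw [← Real.mul_rpow hA.le (h0 t')]
    have : (0 : ℝ) ≤ (t' : ℝ) - t := by have : (t : ℝ) ≤ t' := by exact_mod_cast ht'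
                                        linarith
    calc _ ≤ _ := h2 t' ht'
      _ ≤ A ^ (1 / q) * (t + C') ^ (1 / q) + A ^ (1 / q) * ((t' : ℝ) - t + C') ^ (1 / q) * l +
          A ^ (1 / q) * C' * l := by
        gcongr
        · exact key _ (by positivity)
        · exact key _ this
      _ = _ := by ring

/-! ### Superlevel sets of prescribed measure, used in place of rearrangements. -/

/-- Subsets of every intermediate measure exist. -/
def HasIntermediateSubsets {X : Type*} [MeasurableSpace X] (ν : Measure X) : Prop :=
  ∀ H : Set X, MeasurableSet H → ∀ m ≤ ν H, ∃ H' ⊆ H, MeasurableSet H' ∧ ν H' = m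

/-- The bathtub principle: `G` has a subset of prescribed measure where `v` is largest. -/
theorem HasIntermediateSubsets.exists_superlevel {X : Type*} [MeasurableSpace X] {ν : Measure X}
    [IsFiniteMeasure ν] (hν : HasIntermediateSubsets ν) {v : X → ℝ≥0∞} (hv : Measurable v)
    {G : Set X} (hG : MeasurableSet G) {m : ℝ≥0∞} (hm : m ≤ ν G) :
    ∃ F ⊆ G, MeasurableSet F ∧ ν F = m ∧
      ∃ c : ℝ≥0∞, (∀ x ∈ F, c ≤ v x) ∧ ∀ x ∈ G \ F, v x ≤ c := by
  -- At the supremum `c`, continuity from above gives ν{v ≥ c} ≥ m and continuity from below gives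
  -- ν{v > c} ≤ m, both within G. The missing mass is cut out of {v = c}.
  set S : Set ℝ≥0∞ := {c | m ≤ ν (G ∩ {x | c ≤ v x})} with hS
  set c := sSup S with hc
  have hS0 : (0 : ℝ≥0∞) ∈ S := by simpa [hS] using hm
  have hle : ∀ c : ℝ≥0∞, MeasurableSet {x | c ≤ v x} := fun c => measurableSet_le measurable_const hv
  have h1 : m ≤ ν (G ∩ {x | c ≤ v x}) := by
    obtain ⟨u, hu, hut, huS⟩ := exists_seq_tendsto_sSup ⟨0, hS0⟩ (OrderTop.bddAbove S)
    have heq : G ∩ {x | c ≤ v x} = ⋂ k, G ∩ {x | u k ≤ v x} := by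
      ext x
      simp only [mem_inter_iff, mem_ofPred_eq, mem_iInter]
      constructor
      · rintro ⟨hx, hx'⟩ k
        exact ⟨hx, (le_sSup (huS k)).trans hx'⟩
      · intro h
        exact ⟨(h 0).1, le_of_tendsto' hut fun k => (h k).2⟩
    have := tendsto_measure_iInter_atTop (μ := ν) (s := fun k => G ∩ {x | u k ≤ v x})
      (fun k => (hG.inter (hle _)).nullMeasurableSet)
      (fun i j hij x hx => ⟨hx.1, (hu hij).trans hx.2⟩) ⟨0, measure_ne_top _ _⟩
    rw [heq]
    exact ge_of_tendsto' this fun k => huS k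
  have h2 : ν (G ∩ {x | c < v x}) ≤ m := by
    rcases eq_or_ne c ⊤ with h | h
    · simp [h]
    obtain ⟨u, hu, huI, hut⟩ := exists_seq_strictAnti_tendsto' h.lt_top
    have heq : G ∩ {x | c < v x} = ⋃ k, G ∩ {x | u k ≤ v x} := by
      ext x
      simp only [mem_inter_iff, mem_ofPred_eq, mem_iUnion]
      constructor
      · rintro ⟨hx, hx'⟩
        obtain ⟨k, hk⟩ := ((hut.eventually (gt_mem_nhds hx'))).exists
        exact ⟨k, hx, hk.le⟩
      · rintro ⟨k, hx, hx'⟩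
        exact ⟨hx, (huI k).1.trans_le hx'⟩
    have := tendsto_measure_iUnion_atTop (μ := ν) (s := fun k => G ∩ {x | u k ≤ v x})
      (fun i j hij x hx => ⟨hx.1, (hu.antitone hij).trans hx.2⟩)
    rw [heq]
    refine le_of_tendsto' this fun k => ?_
    by_contra hcon
    exact absurd (le_sSup (show u k ∈ S from (not_le.1 hcon).le)) (not_le.2 (huI k).1)
  have hlt : MeasurableSet (G ∩ {x | c < v x}) := hG.inter (measurableSet_lt measurable_const hv)
  have heqm : MeasurableSet (G ∩ {x | v x = c}) := hG.inter (hv (measurableSet_singleton c))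
  obtain ⟨H', hH', hH'm, hH'ν⟩ := hν _ heqm (m - ν (G ∩ {x | c < v x})) (by
    rw [tsub_le_iff_left]
    refine h1.trans ((measure_mono fun x hx => ?_).trans (measure_union_le _ _))
    rcases (show c ≤ v x from hx.2).lt_or_eq with h | h
    · exact Or.inl ⟨hx.1, h⟩
    · exact Or.inr ⟨hx.1, h.symm⟩)
  refine ⟨G ∩ {x | c < v x} ∪ H', union_subset inter_subset_left (hH'.trans inter_subset_left),
    hlt.union hH'm, ?_, c, ?_, ?_⟩
  · rw [measure_union _ hH'm, hH'ν, add_tsub_cancel_of_le h2]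
    refine disjoint_left.2 fun x hx hx' => ?_
    exact absurd (hH' hx').2 (ne_of_gt hx.2)
  · rintro x (hx | hx)
    · exact le_of_lt hx.2
    · exact (hH' hx).2.ge
  · intro x hx
    by_contra hcon
    exact hx.2 (Or.inl ⟨hx.1, not_le.1 hcon⟩)

/-! ### The Adams inequality for nonnegative kernels on a finite measure space. -/

/-- Size conditions on a kernel under which the Adams inequality holds with constant `A⁻¹`. -/
structure IsAdamsKernel {X : Type*} [MeasurableSpace X] (ν : Measure X) (k : X → X → ℝ≥0∞)
    (p q A C : ℝ) : Prop where
  nonneg : 0 ≤ C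
  aemeasurable : AEMeasurable (Function.uncurry k) (ν.prod ν)
  row : ∀ᵐ x ∂ν, ∀ G, MeasurableSet G → ∀ m : ℝ≥0∞, 0 < m → m ≤ ν G → ∃ B, MeasurableSet B ∧
    ∫⁻ y in G \ B, k x y ^ q ∂ν ≤ ENNReal.ofReal (A * Real.log (ν G / m).toReal + C) ∧
    ∫⁻ y in B, k x y ∂ν ≤ ENNReal.ofReal C * m ^ (1 / p)
  column : ∀ᵐ y ∂ν, ∀ E, MeasurableSet E →
    ∫⁻ x in E, k x y ∂ν ≤ ENNReal.ofReal C * ν E ^ (1 / p)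

section Kernel

variable {X : Type*} [MeasurableSpace X] {ν : Measure X} {k : X → X → ℝ≥0∞} {p q A C : ℝ}

theorem IsAdamsKernel.aemeasurable_row [SFinite ν] (hk : IsAdamsKernel ν k p q A C) :
    ∀ᵐ x ∂ν, AEMeasurable (k x) ν :=
  hk.aemeasurable.aestronglyMeasurable.prodMk_left.mono fun _ h => h.aemeasurable

theorem IsAdamsKernel.aemeasurable_col [SFinite ν] (hk : IsAdamsKernel ν k p q A C) :
    ∀ᵐ y ∂ν, AEMeasurable (fun x => k x y) ν :=
  hk.aemeasurable.aestronglyMeasurable.prod_swap.prodMk_left.mono fun _ h => h.aemeasurable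

/-- Pointwise bound for the part of the potential off a superlevel set of `f`. -/
theorem IsAdamsKernel.lintegral_sdiff_le [SFinite ν] (hk : IsAdamsKernel ν k p q A C)
    (hpq : p.HolderConjugate q) {f : X → ℝ≥0∞} (hf : Measurable f) {F G : Set X}
    (hF : MeasurableSet F) (hG : MeasurableSet G) (hFG : F ⊆ G) (hF0 : 0 < ν F) {c : ℝ≥0∞}
    (hc : ∀ x ∈ F, c ≤ f x) (hc' : ∀ x ∈ G \ F, f x ≤ c) :
    ∀ᵐ x ∂ν, ∫⁻ y in G \ F, k x y * f y ∂ν ≤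
      ENNReal.ofReal (A * Real.log (ν G / ν F).toReal + C) ^ (1 / q) *
        (∫⁻ y in G \ F, f y ^ p ∂ν) ^ (1 / p) +
      ENNReal.ofReal C * (∫⁻ y in F, f y ^ p ∂ν) ^ (1 / p) := by
  have hp := hpq.pos
  have hq := hpq.symm.pos
  filter_upwards [hk.aemeasurable_row, hk.row] with x hx1 hx2
  -- Off `B`, Hölder with the logarithmic row bound. On `B` the singularity is only integrable, but
  -- there f ≤ c, and c ν(F)^{1/p} ≤ ‖f‖_{L^p(F)} because f ≥ c on F.
  obtain ⟨B, hB, hB1, hB2⟩ := hx2 G hG (ν F) hF0 (measure_mono hFG)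
  rw [← lintegral_inter_add_sdiff _ (G \ F) hB, add_comm]
  gcongr
  · calc ∫⁻ y in (G \ F) \ B, k x y * f y ∂ν
        ≤ (∫⁻ y in (G \ F) \ B, k x y ^ q ∂ν) ^ (1 / q) *
          (∫⁻ y in (G \ F) \ B, f y ^ p ∂ν) ^ (1 / p) :=
          ENNReal.lintegral_mul_le_Lp_mul_Lq _ hpq.symm hx1.restrict hf.aemeasurable
      _ ≤ _ := by
          refine mul_le_mul' (ENNReal.rpow_le_rpow ?_ (by positivity))
            (ENNReal.rpow_le_rpow (lintegral_mono_set sdiff_subset) (by positivity))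
          exact (lintegral_mono_set (sdiff_subset_sdiff_left sdiff_subset)).trans hB1
  · have h1 : c * ν F ^ (1 / p) ≤ (∫⁻ y in F, f y ^ p ∂ν) ^ (1 / p) := by
      calc c * ν F ^ (1 / p) = (c ^ p * ν F) ^ (1 / p) := by
            rw [ENNReal.mul_rpow_of_nonneg _ _ (by positivity), ← ENNReal.rpow_mul,
              mul_one_div_cancel hp.ne', ENNReal.rpow_one]
        _ = (∫⁻ _ in F, c ^ p ∂ν) ^ (1 / p) := by rw [setLIntegral_const]
        _ ≤ _ := by
          gcongr ?_ ^ _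
          refine setLIntegral_mono (hf.pow_const p) fun y hy => ?_
          exact ENNReal.rpow_le_rpow (hc y hy) hp.le
    calc ∫⁻ y in (G \ F) ∩ B, k x y * f y ∂ν ≤ ∫⁻ y in (G \ F) ∩ B, k x y * c ∂ν := by
          refine setLIntegral_mono' ((hG.diff hF).inter hB) fun y hy => ?_
          gcongr
          exact hc' y hy.1
      _ ≤ ∫⁻ y in B, k x y * c ∂ν := lintegral_mono_set inter_subset_right
      _ = (∫⁻ y in B, k x y ∂ν) * c := lintegral_mul_const'' _ hx1.restrict
      _ ≤ (ENNReal.ofReal C * ν F ^ (1 / p)) * c := by gcongr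
      _ = ENNReal.ofReal C * (c * ν F ^ (1 / p)) := by ring
      _ ≤ _ := by gcongr

/-- After Tonelli the column bound gives ν(E)^{1/p}, and Hölder on F gives ν(F)^{1/q} ≤ ν(E)^{1/q};
the two powers multiply to ν(E). Thus the mean over E of the potential of f·1_F is at most
C‖f‖_{L^p(F)}. -/
theorem IsAdamsKernel.lintegral_lintegral_le [IsFiniteMeasure ν] (hk : IsAdamsKernel ν k p q A C)
    (hpq : p.HolderConjugate q) {f : X → ℝ≥0∞} (hf : Measurable f) {E F : Set X}
    (hE : MeasurableSet E) (hFE : ν F ≤ ν E) :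
    ∫⁻ x in E, ∫⁻ y in F, k x y * f y ∂ν ∂ν ≤
      ENNReal.ofReal C * (∫⁻ y in F, f y ^ p ∂ν) ^ (1 / p) * ν E := by
  have hp := hpq.pos
  have hq := hpq.symm.pos
  have hm : AEMeasurable (Function.uncurry fun x y => k x y * f y)
      ((ν.restrict E).prod (ν.restrict F)) := by
    rw [Measure.prod_restrict]
    exact (hk.aemeasurable.mul (hf.comp measurable_snd).aemeasurable).restrict
  have hm' : AEMeasurable (Function.uncurry fun y x => k x y * f y)
      ((ν.restrict F).prod (ν.restrict E)) := hm.prod_swap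
  rw [lintegral_lintegral_swap hm]
  calc ∫⁻ y in F, ∫⁻ x in E, k x y * f y ∂ν ∂ν
      ≤ ∫⁻ y in F, (ENNReal.ofReal C * ν E ^ (1 / p)) * f y ∂ν := by
        refine lintegral_mono_ae ?_
        filter_upwards [ae_restrict_of_ae hk.column, ae_restrict_of_ae hk.aemeasurable_col] with y hy hy'
        rw [lintegral_mul_const'' _ hy'.restrict]
        gcongr
        exact hy E hE
    _ = (ENNReal.ofReal C * ν E ^ (1 / p)) * ∫⁻ y in F, f y ∂ν := lintegral_const_mul _ hf
    _ ≤ (ENNReal.ofReal C * ν E ^ (1 / p)) *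
        ((∫⁻ y in F, f y ^ p ∂ν) ^ (1 / p) * ν E ^ (1 / q)) := by
        gcongr
        have := ENNReal.lintegral_mul_le_Lp_mul_Lq (ν.restrict F) hpq (f := f) (g := fun _ => 1)
          hf.aemeasurable aemeasurable_const
        simp only [Pi.mul_apply, mul_one, ENNReal.one_rpow, setLIntegral_const, one_mul] at this
        refine this.trans ?_
        gcongr
    _ = ENNReal.ofReal C * (∫⁻ y in F, f y ^ p ∂ν) ^ (1 / p) *
        (ν E ^ (1 / p) * ν E ^ (1 / q)) := by ring
    _ = _ := by
        rw [← ENNReal.rpow_add_of_nonneg _ _ (by positivity) (by positivity), one_div, one_div,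
          hpq.inv_add_inv_eq_one, ENNReal.rpow_one]

/-- Averaging over a superlevel set `E` of the potential. -/
theorem IsAdamsKernel.le_of_le_potential [IsFiniteMeasure ν] (hk : IsAdamsKernel ν k p q A C)
    (hpq : p.HolderConjugate q) {f : X → ℝ≥0∞} (hf : Measurable f) {E F : Set X}
    (hE : MeasurableSet E) (hE0 : ν E ≠ 0) (hF : MeasurableSet F) (hFE : ν F ≤ ν E) {H a : ℝ≥0∞}
    (hH : ∀ᵐ x ∂ν, x ∈ E → H ≤ ∫⁻ y, k x y * f y ∂ν)
    (ha : ∀ᵐ x ∂ν, ∫⁻ y in Fᶜ, k x y * f y ∂ν ≤ a) :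
    H ≤ a + ENNReal.ofReal C * (∫⁻ y in F, f y ^ p ∂ν) ^ (1 / p) := by
  -- The contribution of F is controlled only on average over E, not pointwise; this suffices
  -- because the whole potential is at least H almost everywhere on E.
  have h : H * ν E ≤ (a + ENNReal.ofReal C * (∫⁻ y in F, f y ^ p ∂ν) ^ (1 / p)) * ν E := by
    calc H * ν E = ∫⁻ _ in E, H ∂ν := (setLIntegral_const _ _).symm
      _ ≤ ∫⁻ x in E, (a + ∫⁻ y in F, k x y * f y ∂ν) ∂ν := by
          refine setLIntegral_mono_ae' hE ?_
          filter_upwards [hH, ha] with x hx hx' hxE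
          refine (hx hxE).trans ?_
          rw [← lintegral_add_compl _ hF, add_comm]
          gcongr
      _ = a * ν E + ∫⁻ x in E, ∫⁻ y in F, k x y * f y ∂ν ∂ν := by
          rw [lintegral_add_left measurable_const, setLIntegral_const]
      _ ≤ _ := by
          rw [add_mul]
          gcongr
          exact hk.lintegral_lintegral_le hpq hf hE hFE
  exact (ENNReal.mul_le_mul_iff_left hE0 (measure_ne_top _ _)).1 h

/-- The sets need not be nested. Almost every point lies in `E 0` and has a first index t + 1 at
which it is outside, so u ≤ h(t + 1) there while the point is still in `E t`. Pairing h(t + 1) with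
the measure of `E t` costs the factor e. -/
theorem lintegral_exp_le_of_superlevel [IsFiniteMeasure ν] {u : X → ℝ≥0∞} {E : ℕ → Set X}
    (hE : ∀ t, MeasurableSet (E t))
    (hνE : ∀ t : ℕ, ν (E t) = ν univ * ENNReal.ofReal (Real.exp (-t))) {h : ℕ → ℝ}
    (hu : ∀ t x, x ∉ E t → u x ≤ ENNReal.ofReal (h t)) (h0 : ∀ t, 0 ≤ h t) :
    ∫⁻ x, ENNReal.ofReal (Real.exp (u x).toReal) ∂ν ≤
      ν univ * ENNReal.ofReal (Real.exp 1) *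
        ∑' t : ℕ, ENNReal.ofReal (Real.exp (-(t - h t))) := by
  have hnull : ν (⋂ t, E t) = 0 := by
    have h1 : Tendsto (fun t : ℕ => ν univ * ENNReal.ofReal (Real.exp (-t))) atTop (𝓝 0) := by
      have h2 : Tendsto (fun t : ℕ => Real.exp (-(t : ℝ))) atTop (𝓝 0) :=
        Real.tendsto_exp_neg_atTop_nhds_zero.comp tendsto_natCast_atTop_atTop
      have h3 := ENNReal.tendsto_ofReal h2
      rw [ENNReal.ofReal_zero] at h3
      simpa using ENNReal.Tendsto.const_mul h3 (Or.inr (measure_ne_top ν univ))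
    refine le_antisymm (ge_of_tendsto' h1 fun t => ?_) bot_le
    rw [← hνE]
    exact measure_mono (iInter_subset _ _)
  have hE0 : ∀ᵐ x ∂ν, x ∈ E 0 := by
    rw [ae_iff]
    change ν (E 0)ᶜ = 0
    rw [measure_compl (hE 0) (measure_ne_top _ _), hνE]
    simp
  have hpt : ∀ᵐ x ∂ν, ENNReal.ofReal (Real.exp (u x).toReal) ≤
      ∑' t : ℕ, (E t).indicator (fun _ => ENNReal.ofReal (Real.exp (h (t + 1)))) x := by
    filter_upwards [hE0, measure_eq_zero_iff_ae_notMem.1 hnull] with x hx0 hx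
    have hex : ∃ t, x ∉ E t := by simpa using hx
    classical
    obtain ⟨t, ht⟩ : ∃ t, Nat.find hex = t + 1 :=
      Nat.exists_eq_succ_of_ne_zero fun h => Nat.find_spec hex (h ▸ hx0)
    have h1 : x ∉ E (t + 1) := ht ▸ Nat.find_spec hex
    have h2 : x ∈ E t := by
      by_contra hcon
      have := Nat.find_min' hex hcon
      omega
    refine le_trans ?_ (ENNReal.le_tsum t)
    rw [indicator_of_mem h2]
    refine ENNReal.ofReal_le_ofReal (Real.exp_le_exp.2 ?_)
    exact ENNReal.toReal_le_of_le_ofReal (h0 _) (hu _ _ h1)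
  calc _ ≤ ∫⁻ x, ∑' t : ℕ, (E t).indicator
        (fun _ => ENNReal.ofReal (Real.exp (h (t + 1)))) x ∂ν := lintegral_mono_ae hpt
    _ = ∑' t : ℕ, ENNReal.ofReal (Real.exp (h (t + 1))) * ν (E t) := by
        rw [lintegral_tsum fun t => (measurable_const.indicator (hE t)).aemeasurable]
        congr 1; ext t
        rw [lintegral_indicator_const (hE t)]
    _ = ν univ * ENNReal.ofReal (Real.exp 1) *
        ∑' t : ℕ, ENNReal.ofReal (Real.exp (-((t + 1 : ℕ) - h (t + 1)))) := by
        rw [← ENNReal.tsum_mul_left]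
        congr 1; ext t
        rw [hνE, mul_left_comm, mul_assoc, ← ENNReal.ofReal_mul (by positivity),
          ← ENNReal.ofReal_mul (by positivity), ← Real.exp_add, ← Real.exp_add]
        congr 3
        push_cast; ring
    _ ≤ _ := by
        refine mul_le_mul_right ?_ _
        exact ENNReal.tsum_comp_le_tsum_of_injective (add_left_injective 1)
          fun t : ℕ => ENNReal.ofReal (Real.exp (-(t - h t)))

/-- The Adams inequality on a finite measure space. -/
theorem IsAdamsKernel.lintegral_exp_le [IsFiniteMeasure ν] (hν : HasIntermediateSubsets ν)
    (hk : IsAdamsKernel ν k p q A C) (hpq : p.HolderConjugate q) (hA : 0 < A) :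
    ∃ C' : ℝ, 0 < C' ∧ ∀ f : X → ℝ≥0∞, Measurable f → ∫⁻ y, f y ^ p ∂ν ≤ 1 →
      ∫⁻ x, ENNReal.ofReal (Real.exp (A⁻¹ * (∫⁻ y, k x y * f y ∂ν).toReal ^ q)) ∂ν ≤
        ENNReal.ofReal C' := by
  have hp := hpq.pos
  have hq := hpq.symm.pos
  have hC := hk.nonneg
  rcases eq_or_ne (ν univ) 0 with hW0 | hW0
  · refine ⟨1, one_pos, fun f _ _ => ?_⟩
    rw [Measure.measure_univ_eq_zero.1 hW0]; simp
  -- The two-scale estimate collects three errors of size C l, hence 3C.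
  obtain ⟨C₀, C₁, hC₁, hgap⟩ := garsia_gap hpq hA (by positivity : 0 ≤ 3 * C)
  obtain ⟨C₂, hC₂, hsum⟩ := tsum_exp_neg_le_of_gap C₀ C₁ hC₁
  refine ⟨(ν univ).toReal * Real.exp 1 * C₂,
    mul_pos (mul_pos (ENNReal.toReal_pos hW0 (measure_ne_top _ _)) (Real.exp_pos 1)) hC₂,
    fun f hf hf1 => ?_⟩
  set u : X → ℝ≥0∞ := fun x => ENNReal.ofReal A⁻¹ * (∫⁻ y, k x y * f y ∂ν) ^ q with hu
  have hum : AEMeasurable u ν := by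
    refine (AEMeasurable.pow_const ?_ q).const_mul _
    exact AEMeasurable.lintegral_prod_right' (f := fun z => k z.1 z.2 * f z.2)
      (hk.aemeasurable.mul (hf.comp measurable_snd).aemeasurable)
  have hm : ∀ t : ℕ, ν univ * ENNReal.ofReal (Real.exp (-t)) ≤ ν univ := fun t => by
    refine mul_le_of_le_one_right' ?_
    rw [ENNReal.ofReal_le_one, Real.exp_le_one_iff]
    simp
  have hm0 : ∀ t : ℕ, 0 < ν univ * ENNReal.ofReal (Real.exp (-t)) := fun t =>
    ENNReal.mul_pos hW0 (by simpa using Real.exp_pos _)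
  -- `h t` plays the role of the decreasing rearrangement of u at measure e^{-t} ν(X).
  choose E _ hE hνE h hEh hEh' using fun t =>
    hν.exists_superlevel hum.measurable_mk MeasurableSet.univ (hm t)
  set H : ℕ → ℝ≥0∞ := fun t => (ENNReal.ofReal A * h t) ^ (1 / q) with hH
  have hHle : ∀ t, ∀ᵐ x ∂ν, x ∈ E t → H t ≤ ∫⁻ y, k x y * f y ∂ν := by
    intro t
    filter_upwards [hum.ae_eq_mk] with x hx hxE
    have h1 : h t ≤ u x := hx ▸ hEh t x hxE
    calc H t ≤ (ENNReal.ofReal A * u x) ^ (1 / q) := by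
          simp only [hH]; gcongr
      _ = _ := by
          simp only [hu]
          rw [← mul_assoc, ← ENNReal.ofReal_mul hA.le, mul_inv_cancel₀ hA.ne', ENNReal.ofReal_one,
            one_mul, ← ENNReal.rpow_mul, mul_one_div_cancel hq.ne', ENNReal.rpow_one]
  have hlog : ∀ t t' : ℕ, Real.log (ν univ * ENNReal.ofReal (Real.exp (-t)) /
      (ν univ * ENNReal.ofReal (Real.exp (-t')))).toReal = (t' : ℝ) - t := by
    intro t t'
    have hW : (ν univ).toReal ≠ 0 := (ENNReal.toReal_pos hW0 (measure_ne_top _ _)).ne'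
    rw [ENNReal.toReal_div, ENNReal.toReal_mul, ENNReal.toReal_mul,
      ENNReal.toReal_ofReal (Real.exp_pos _).le, ENNReal.toReal_ofReal (Real.exp_pos _).le,
      mul_div_mul_left _ _ hW, ← Real.exp_sub, Real.log_exp]
    ring
  have hpt : ∀ t : ℕ, ∃ l : ℝ, 0 ≤ l ∧ l ≤ 1 ∧
      H t ≤ ENNReal.ofReal ((A * t + 3 * C) ^ (1 / q) * (1 - l ^ p) ^ (1 / p) + 3 * C * l) ∧
      ∀ t' : ℕ, t ≤ t' → H t' ≤ ENNReal.ofReal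
        ((A * t + 3 * C) ^ (1 / q) + (A * ((t' : ℝ) - t) + 3 * C) ^ (1 / q) * l + 3 * C * l) := by
    intro t
    obtain ⟨F, -, hF, hνF, c, hc, hc'⟩ := hν.exists_superlevel hf MeasurableSet.univ (hm t)
    have hF1 : ∫⁻ y in F, f y ^ p ∂ν ≤ 1 := (setLIntegral_le_lintegral _ _).trans hf1
    have hFt : ∫⁻ y in F, f y ^ p ∂ν ≠ ⊤ := ne_top_of_le_ne_top ENNReal.one_ne_top hF1
    -- `l` is ‖f‖_{L^p(F)}; since ‖f‖_p ≤ 1, the norm off F is at most (1 - l^p)^{1/p}.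
    set l : ℝ := (∫⁻ y in F, f y ^ p ∂ν).toReal ^ (1 / p) with hl
    have hl0 : 0 ≤ l := by positivity
    have hlE : (∫⁻ y in F, f y ^ p ∂ν) ^ (1 / p) = ENNReal.ofReal l := by
      rw [hl, ← ENNReal.ofReal_rpow_of_nonneg ENNReal.toReal_nonneg (by positivity),
        ENNReal.ofReal_toReal hFt]
    have hlp : ENNReal.ofReal (l ^ p) = ∫⁻ y in F, f y ^ p ∂ν := by
      rw [← ENNReal.ofReal_rpow_of_nonneg hl0 hp.le, ← hlE, ← ENNReal.rpow_mul,
        one_div_mul_cancel hp.ne', ENNReal.rpow_one]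
    have hl1 : l ≤ 1 := by
      rw [← ENNReal.ofReal_le_one, ← hlE]
      exact ENNReal.rpow_le_one hF1 (by positivity)
    have hlp1 : 0 ≤ 1 - l ^ p := by linarith [Real.rpow_le_one hl0 hl1 hp.le]
    have hcompl : (∫⁻ y in univ \ F, f y ^ p ∂ν) ^ (1 / p) ≤
        ENNReal.ofReal ((1 - l ^ p) ^ (1 / p)) := by
      rw [← ENNReal.ofReal_rpow_of_nonneg hlp1 (by positivity)]
      refine ENNReal.rpow_le_rpow ?_ (by positivity)
      rw [ENNReal.ofReal_sub _ (by positivity), hlp, ENNReal.ofReal_one]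
      refine ENNReal.le_sub_of_add_le_right hFt ?_
      rw [add_comm, ← compl_eq_univ_sdiff, lintegral_add_compl _ hF]
      exact hf1
    have hmain := hk.lintegral_sdiff_le hpq hf hF MeasurableSet.univ (subset_univ F)
      (hνF ▸ hm0 t) hc hc'
    have hlog0 : Real.log (ν univ / ν F).toReal = t := by
      have := hlog 0 t
      simpa [hνF] using this
    rw [hlog0, hlE] at hmain
    have hAt : 0 ≤ A * t + C := by positivity
    refine ⟨l, hl0, hl1, ?_, fun t' htt' => ?_⟩
    · have h1 := hk.le_of_le_potential hpq hf (hE t) (hνE t ▸ (hm0 t).ne') hF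
        (hνF.trans (hνE t).symm).le (hHle t) (by simpa only [compl_eq_univ_sdiff] using hmain)
      refine h1.trans ?_
      calc _ ≤ ENNReal.ofReal (A * t + C) ^ (1 / q) * ENNReal.ofReal ((1 - l ^ p) ^ (1 / p)) +
            ENNReal.ofReal C * ENNReal.ofReal l + ENNReal.ofReal C * ENNReal.ofReal l := by
            rw [hlE]; gcongr
        _ = ENNReal.ofReal ((A * t + C) ^ (1 / q) * (1 - l ^ p) ^ (1 / p) + C * l + C * l) := by
            rw [ENNReal.ofReal_rpow_of_nonneg hAt (by positivity),
              ENNReal.ofReal_add (by positivity) (by positivity),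
              ENNReal.ofReal_add (by positivity) (by positivity),
              ENNReal.ofReal_mul (by positivity), ENNReal.ofReal_mul hC]
        _ ≤ _ := by
            refine ENNReal.ofReal_le_ofReal ?_
            have h2 : (A * t + C) ^ (1 / q) ≤ (A * t + 3 * C) ^ (1 / q) := by
              gcongr; linarith
            have h3 := mul_le_mul_of_nonneg_right h2
              (by positivity : 0 ≤ (1 - l ^ p) ^ (1 / p))
            have h4 : 0 ≤ C * l := by positivity
            linarith
    · have hle : ν univ * ENNReal.ofReal (Real.exp (-t')) ≤ ν F := by
        rw [hνF]; gcongr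
      -- Choosing F' inside F makes the logarithm on F \ F' equal to t' - t, and the norm of f there
      -- is at most l.
      obtain ⟨F', hF'F, hF', hνF', c', hcc, hcc'⟩ := hν.exists_superlevel hf hF hle
      have hmain' := hk.lintegral_sdiff_le hpq hf hF' hF hF'F (hνF' ▸ hm0 t') hcc hcc'
      rw [hνF, hνF', hlog t t'] at hmain'
      have hl' : (∫⁻ y in F', f y ^ p ∂ν) ^ (1 / p) ≤ ENNReal.ofReal l := by
        rw [← hlE]
        exact ENNReal.rpow_le_rpow (lintegral_mono_set hF'F) (by positivity)
      have hl'' : (∫⁻ y in F \ F', f y ^ p ∂ν) ^ (1 / p) ≤ ENNReal.ofReal l := by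
        rw [← hlE]
        exact ENNReal.rpow_le_rpow (lintegral_mono_set sdiff_subset) (by positivity)
      have hcomb : ∀ᵐ x ∂ν, ∫⁻ y in F'ᶜ, k x y * f y ∂ν ≤
          (ENNReal.ofReal (A * t + C) ^ (1 / q) + ENNReal.ofReal C * ENNReal.ofReal l) +
          (ENNReal.ofReal (A * ((t' : ℝ) - t) + C) ^ (1 / q) * ENNReal.ofReal l +
            ENNReal.ofReal C * ENNReal.ofReal l) := by
        filter_upwards [hmain, hmain'] with x hx hx'
        have hsub : F'ᶜ ⊆ (univ \ F) ∪ (F \ F') := fun y hy => by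
          by_cases hyF : y ∈ F
          · exact Or.inr ⟨hyF, hy⟩
          · exact Or.inl ⟨mem_univ _, hyF⟩
        refine (lintegral_mono_set hsub).trans ((lintegral_union_le _ _ _).trans ?_)
        refine add_le_add (hx.trans ?_) (hx'.trans ?_)
        · gcongr
          refine mul_le_of_le_one_right' (hcompl.trans ?_)
          rw [ENNReal.ofReal_le_one]
          refine Real.rpow_le_one hlp1 ?_ (by positivity)
          have : 0 ≤ l ^ p := by positivity
          linarith
        · gcongr
      have h1 := hk.le_of_le_potential hpq hf (hE t') (hνE t' ▸ (hm0 t').ne') hF'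
        (hνF'.trans (hνE t').symm).le (hHle t') hcomb
      have htt : (0 : ℝ) ≤ (t' : ℝ) - t := sub_nonneg.2 (by exact_mod_cast htt')
      refine h1.trans ?_
      calc _ ≤ (ENNReal.ofReal (A * t + C) ^ (1 / q) + ENNReal.ofReal C * ENNReal.ofReal l) +
          (ENNReal.ofReal (A * ((t' : ℝ) - t) + C) ^ (1 / q) * ENNReal.ofReal l +
            ENNReal.ofReal C * ENNReal.ofReal l) + ENNReal.ofReal C * ENNReal.ofReal l := by gcongr
        _ = ENNReal.ofReal (((A * t + C) ^ (1 / q) + C * l) +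
            ((A * ((t' : ℝ) - t) + C) ^ (1 / q) * l + C * l) + C * l) := by
            rw [ENNReal.ofReal_rpow_of_nonneg hAt (by positivity),
              ENNReal.ofReal_rpow_of_nonneg (by positivity) (by positivity),
              ENNReal.ofReal_add (by positivity) (by positivity),
              ENNReal.ofReal_add (by positivity) (by positivity),
              ENNReal.ofReal_add (by positivity) (by positivity),
              ENNReal.ofReal_add (by positivity) (by positivity),
              ENNReal.ofReal_mul hC,
              ENNReal.ofReal_mul (by positivity : 0 ≤ (A * ((t' : ℝ) - t) + C) ^ (1 / q))]
        _ ≤ _ := by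
            refine ENNReal.ofReal_le_ofReal ?_
            have h2 : (A * t + C) ^ (1 / q) ≤ (A * t + 3 * C) ^ (1 / q) := by
              gcongr; linarith
            have h3 : (A * ((t' : ℝ) - t) + C) ^ (1 / q) * l ≤
                (A * ((t' : ℝ) - t) + 3 * C) ^ (1 / q) * l := by
              gcongr; linarith
            linarith
  have hHt : ∀ t, H t ≠ ⊤ := fun t => by
    obtain ⟨l, -, -, h1, -⟩ := hpt t
    exact ne_top_of_le_ne_top ENNReal.ofReal_ne_top h1
  have hht : ∀ t, h t ≠ ⊤ := fun t ht => by
    refine hHt t ?_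
    simp only [hH, ht]
    rw [ENNReal.mul_top (by simpa using hA), ENNReal.top_rpow_of_pos (by positivity)]
  have hHr : ∀ t, H t = ENNReal.ofReal ((A * (h t).toReal) ^ (1 / q)) := fun t => by
    rw [← ENNReal.ofReal_rpow_of_nonneg (by positivity) (by positivity), ENNReal.ofReal_mul hA.le,
      ENNReal.ofReal_toReal (hht t)]
  obtain ⟨g1, g2⟩ := hgap (fun t => (h t).toReal) (fun t => ENNReal.toReal_nonneg) fun t => by
    obtain ⟨l, hl0, hl1, h1, h2⟩ := hpt t
    have hlp1 : 0 ≤ 1 - l ^ p := by linarith [Real.rpow_le_one hl0 hl1 hp.le]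
    refine ⟨l, hl0, hl1, ?_, fun t' ht' => ?_⟩
    · rw [hHr, ENNReal.ofReal_le_ofReal_iff (by positivity)] at h1
      exact h1
    · have htt : (0 : ℝ) ≤ (t' : ℝ) - t := sub_nonneg.2 (by exact_mod_cast ht')
      have h3 := h2 t' ht'
      rw [hHr, ENNReal.ofReal_le_ofReal_iff (by positivity)] at h3
      exact h3
  have hfin := lintegral_exp_le_of_superlevel (u := hum.mk u) hE hνE (h := fun t => (h t).toReal)
    (fun t x hx => by
      rw [ENNReal.ofReal_toReal (hht t)]
      exact hEh' t x ⟨mem_univ _, hx⟩) fun t => ENNReal.toReal_nonneg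
  calc _ = ∫⁻ x, ENNReal.ofReal (Real.exp (hum.mk u x).toReal) ∂ν := by
        refine lintegral_congr_ae ?_
        filter_upwards [hum.ae_eq_mk] with x hx
        rw [← hx]
        simp only [hu]
        rw [ENNReal.toReal_mul, ENNReal.toReal_ofReal (by positivity), ENNReal.toReal_rpow]
    _ ≤ _ := hfin
    _ ≤ ν univ * ENNReal.ofReal (Real.exp 1) * ENNReal.ofReal C₂ := by
        gcongr
        exact hsum _ g1 g2
    _ = _ := by
        rw [ENNReal.ofReal_mul (by positivity), ENNReal.ofReal_mul (by positivity),
          ENNReal.ofReal_toReal (measure_ne_top _ _)]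

end Kernel

/-! ### Polar coordinates and intermediate subsets in Euclidean space. -/

/-- Integration in polar coordinates of a product of a radial and an angular function. -/
theorem lintegral_radial_mul_angular {E : Type*} [NormedAddCommGroup E] [NormedSpace ℝ E]
    [FiniteDimensional ℝ E] [Nontrivial E] [MeasurableSpace E] [BorelSpace E] (μ : Measure E)
    [μ.IsAddHaarMeasure] {φ : ℝ → ℝ≥0∞} (hφ : Measurable φ) {G : E → ℝ≥0∞}
    (hG : AEMeasurable (fun ω : Metric.sphere (0 : E) 1 => G ω) μ.toSphere) :
    ∫⁻ z, φ ‖z‖ * G (‖z‖⁻¹ • z) ∂μ = (∫⁻ ω : Metric.sphere (0 : E) 1, G ω ∂μ.toSphere) *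
      ∫⁻ s in Ioi (0 : ℝ), ENNReal.ofReal (s ^ (Module.finrank ℝ E - 1)) * φ s := by
  calc ∫⁻ z, φ ‖z‖ * G (‖z‖⁻¹ • z) ∂μ
      = ∫⁻ z : ({(0 : E)}ᶜ : Set E), φ ‖(z : E)‖ * G (‖(z : E)‖⁻¹ • (z : E))
          ∂(μ.comap Subtype.val) := by
        rw [lintegral_subtype_comap (measurableSet_singleton _).compl
          fun z => φ ‖z‖ * G (‖z‖⁻¹ • z), restrict_compl_singleton]
    _ = ∫⁻ w : Metric.sphere (0 : E) 1 × Ioi (0 : ℝ), G w.1 * φ w.2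
          ∂(μ.toSphere.prod (.volumeIoiPow (Module.finrank ℝ E - 1))) := by
        rw [← μ.measurePreserving_homeomorphUnitSphereProd.lintegral_comp_emb
          (Homeomorph.measurableEmbedding _)]
        simp [mul_comm]
    _ = (∫⁻ ω : Metric.sphere (0 : E) 1, G ω ∂μ.toSphere) *
          ∫⁻ s : Ioi (0 : ℝ), φ s ∂(.volumeIoiPow (Module.finrank ℝ E - 1)) :=
        lintegral_prod_mul hG (hφ.comp measurable_subtype_coe).aemeasurable
    _ = _ := by
        rw [Measure.volumeIoiPow, lintegral_withDensity_eq_lintegral_mul _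
          (measurable_subtype_coe.pow_const _).ennreal_ofReal (g := fun s : Ioi (0 : ℝ) => φ s) (hφ.comp measurable_subtype_coe)]
        congr 1
        exact lintegral_subtype_comap measurableSet_Ioi
          fun s : ℝ => ENNReal.ofReal (s ^ (Module.finrank ℝ E - 1)) * φ s

section Euclidean

variable {n : ℕ}

local notation "𝔼" => EuclideanSpace ℝ (Fin n)

/-- The exponent is normalised as b - n so that the Jacobian s^{n-1} leaves s^{b-1}: balls use b >
0, exteriors b < 0, annuli the critical b = 0. -/
theorem lintegral_polar (hn : 0 < n) (x : 𝔼) {I : Set ℝ} (hI : MeasurableSet I) (b : ℝ)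
    {G : 𝔼 → ℝ≥0∞}
    (hG : AEMeasurable (fun ω : Metric.sphere (0 : 𝔼) 1 => G ω) (volume : Measure 𝔼).toSphere) :
    ∫⁻ y in {y : 𝔼 | ‖y - x‖ ∈ I},
        ENNReal.ofReal (‖y - x‖ ^ (b - n)) * G (‖y - x‖⁻¹ • (y - x)) =
      (∫⁻ ω : Metric.sphere (0 : 𝔼) 1, G ω ∂(volume : Measure 𝔼).toSphere) *
        ∫⁻ s in I ∩ Ioi 0, ENNReal.ofReal (s ^ (b - 1)) := by
  have : Nonempty (Fin n) := ⟨⟨0, hn⟩⟩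
  have hS : MeasurableSet {y : 𝔼 | ‖y - x‖ ∈ I} :=
    (by fun_prop : Measurable fun y : 𝔼 => ‖y - x‖) hI
  have hφ : Measurable (I.indicator fun s : ℝ => ENNReal.ofReal (s ^ (b - n))) :=
    (by fun_prop : Measurable fun s : ℝ => ENNReal.ofReal (s ^ (b - n))).indicator hI
  rw [← lintegral_indicator hS]
  have h1 : ∀ y : 𝔼, ({y : 𝔼 | ‖y - x‖ ∈ I}.indicator (fun y =>
      ENNReal.ofReal (‖y - x‖ ^ (b - n)) * G (‖y - x‖⁻¹ • (y - x)))) y =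
      (fun z : 𝔼 => (I.indicator fun s : ℝ => ENNReal.ofReal (s ^ (b - n))) ‖z‖ *
        G (‖z‖⁻¹ • z)) (y - x) := by
    intro y
    by_cases hy : ‖y - x‖ ∈ I
    · have : y ∈ {y : 𝔼 | ‖y - x‖ ∈ I} := hy
      simp only [indicator_of_mem hy, indicator_of_mem this]
    · have : y ∉ {y : 𝔼 | ‖y - x‖ ∈ I} := hy
      simp only [indicator_of_notMem hy, indicator_of_notMem this, zero_mul]
  rw [lintegral_congr h1, lintegral_sub_right_eq_self (μ := (volume : Measure 𝔼))
    (fun z : 𝔼 => (I.indicator fun s : ℝ => ENNReal.ofReal (s ^ (b - n))) ‖z‖ *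
        G (‖z‖⁻¹ • z)) x, lintegral_radial_mul_angular _ hφ hG, finrank_euclideanSpace_fin]
  congr 1
  rw [← setLIntegral_indicator hI]
  refine setLIntegral_congr_fun measurableSet_Ioi fun s hs => ?_
  have hs : 0 < s := hs
  by_cases hsI : s ∈ I
  · simp only [indicator_of_mem hsI]
    rw [← ENNReal.ofReal_mul (by positivity), ← Real.rpow_natCast, ← Real.rpow_add hs]
    congr 2
    rw [Nat.cast_sub hn]; push_cast; ring
  · simp only [indicator_of_notMem hsI, mul_zero]

theorem lintegral_rpow_Ioo {r a : ℝ} (hr : 0 ≤ r) (ha : 0 < a) :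
    ∫⁻ s in Ioo 0 r, ENNReal.ofReal (s ^ (a - 1)) = ENNReal.ofReal (r ^ a / a) := by
  have hi := (intervalIntegral.intervalIntegrable_rpow' (a := 0) (b := r)
    (by linarith : -1 < a - 1)).1
  rw [Measure.restrict_congr_set Ioo_ae_eq_Ioc, ← ofReal_integral_eq_lintegral_ofReal hi,
    ← intervalIntegral.integral_of_le hr, integral_rpow (Or.inl (by linarith)), sub_add_cancel,
    Real.zero_rpow ha.ne', sub_zero]
  filter_upwards [ae_restrict_mem measurableSet_Ioc] with s hs
  exact Real.rpow_nonneg hs.1.le _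

theorem lintegral_rpow_Ici {r a : ℝ} (hr : 0 < r) (ha : 0 < a) :
    ∫⁻ s in Ici r, ENNReal.ofReal (s ^ (-a - 1)) = ENNReal.ofReal (r ^ (-a) / a) := by
  rw [Measure.restrict_congr_set Ioi_ae_eq_Ici.symm, ← ofReal_integral_eq_lintegral_ofReal
    (integrableOn_Ioi_rpow_of_lt (by linarith) hr), integral_Ioi_rpow_of_lt (by linarith) hr,
    sub_add_cancel, neg_div_neg_eq]
  filter_upwards [ae_restrict_mem measurableSet_Ioi] with s hs
  exact Real.rpow_nonneg (hr.le.trans (le_of_lt hs)) _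

theorem lintegral_inv_Ico {r R : ℝ} (hr : 0 < r) (hR : r ≤ R) :
    ∫⁻ s in Ico r R, ENNReal.ofReal (s ^ ((0 : ℝ) - 1)) = ENNReal.ofReal (Real.log (R / r)) := by
  have h0 : (0 : ℝ) ∉ uIcc r R := by
    rw [uIcc_of_le hR]; exact fun h => absurd h.1 (not_le.2 hr)
  have hi : IntegrableOn (fun s : ℝ => s ^ ((0 : ℝ) - 1)) (Ioc r R) :=
    (intervalIntegral.intervalIntegrable_rpow (Or.inr h0)).1
  rw [Measure.restrict_congr_set Ico_ae_eq_Ioc, ← ofReal_integral_eq_lintegral_ofReal hi,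
    ← intervalIntegral.integral_of_le hR]
  · congr 1
    rw [← integral_inv h0]
    congr 1
    ext s
    rw [zero_sub, Real.rpow_neg_one]
  · filter_upwards [ae_restrict_mem measurableSet_Ioc] with s hs
    exact Real.rpow_nonneg (hr.le.trans hs.1.le) _

theorem lintegral_ball_rpow (hn : 0 < n) (x : 𝔼) {r a : ℝ} (hr : 0 ≤ r) (ha : 0 < a) :
    ∫⁻ y in Metric.ball x r, ENNReal.ofReal (‖y - x‖ ^ (a - n)) =
      (volume : Measure 𝔼).toSphere univ * ENNReal.ofReal (r ^ a / a) := by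
  have := lintegral_polar hn x (measurableSet_Iio (a := r)) a (G := fun _ => 1) aemeasurable_const
  simp only [mul_one, lintegral_one] at this
  rw [← lintegral_rpow_Ioo hr ha, ← Ioi_inter_Iio, inter_comm, ← this]
  congr 2

theorem lintegral_compl_ball_rpow (hn : 0 < n) (x : 𝔼) {r a : ℝ} (hr : 0 < r) (ha : 0 < a) :
    ∫⁻ y in (Metric.ball x r)ᶜ, ENNReal.ofReal (‖y - x‖ ^ (-a - n)) =
      (volume : Measure 𝔼).toSphere univ * ENNReal.ofReal (r ^ (-a) / a) := by
  have := lintegral_polar hn x (measurableSet_Ici (a := r)) (-a) (G := fun _ => 1)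
    aemeasurable_const
  simp only [mul_one, lintegral_one] at this
  rw [inter_eq_left.2 (show Ici r ⊆ Ioi 0 from fun s hs => lt_of_lt_of_le hr hs), lintegral_rpow_Ici hr ha] at this
  rw [← this]
  congr 2
  ext y
  simp [dist_eq_norm]

/-- The weight |y-x|^{-n} is scale invariant; this is the source of the logarithm in both halves of
the theorem. -/
theorem lintegral_annulus (hn : 0 < n) (x : 𝔼) {r R : ℝ} (hr : 0 < r) (hR : r ≤ R)
    {G : 𝔼 → ℝ≥0∞}
    (hG : AEMeasurable (fun ω : Metric.sphere (0 : 𝔼) 1 => G ω) (volume : Measure 𝔼).toSphere) :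
    ∫⁻ y in Metric.ball x R \ Metric.ball x r,
        ENNReal.ofReal (‖y - x‖ ^ (-n : ℝ)) * G (‖y - x‖⁻¹ • (y - x)) =
      (∫⁻ ω : Metric.sphere (0 : 𝔼) 1, G ω ∂(volume : Measure 𝔼).toSphere) *
        ENNReal.ofReal (Real.log (R / r)) := by
  have := lintegral_polar hn x (measurableSet_Ico (a := r) (b := R)) 0 hG
  rw [inter_eq_left.2 (show Ico r R ⊆ Ioi 0 from fun s hs => lt_of_lt_of_le hr hs.1), lintegral_inv_Ico hr hR,
    zero_sub] at this
  rw [← this]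
  congr 2
  ext y
  simp [dist_eq_norm, and_comm]

/-- Spheres are null, so the measure of H ∩ Ω inside a closed ball varies continuously with the
radius; the intermediate value theorem runs from radius -1, where the ball is empty, to one
containing Ω. -/
theorem hasIntermediateSubsets_restrict (hn : 0 < n) {Ω : Set 𝔼} (hΩ : Bornology.IsBounded Ω) :
    HasIntermediateSubsets ((volume : Measure 𝔼).restrict Ω) := by
  have : Nonempty (Fin n) := ⟨⟨0, hn⟩⟩
  intro H hH m hm
  obtain ⟨R, hR0, hR⟩ := hΩ.subset_ball_lt 0 (0 : 𝔼)
  have hfin : (volume : Measure 𝔼) Ω ≠ ⊤ := hΩ.measure_lt_top.ne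
  have : IsFiniteMeasure ((volume : Measure 𝔼).restrict Ω) :=
    isFiniteMeasure_restrict.2 hfin
  set ν := ((volume : Measure 𝔼).restrict Ω).restrict H
  set φ : ℝ → ℝ := fun r => ∫ y, (Metric.closedBall (0 : 𝔼) r).indicator (fun _ => (1 : ℝ)) y ∂ν
    with hφ
  have hφr : ∀ r, φ r = ν.real (Metric.closedBall 0 r) := fun r =>
    integral_indicator_one measurableSet_closedBall
  have hcont : Continuous φ := by
    refine continuous_iff_continuousAt.2 fun r₀ => ?_
    refine continuousAt_of_dominated (bound := fun _ => 1) (.of_forall fun r =>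
      (measurable_const.indicator measurableSet_closedBall).aestronglyMeasurable)
      (.of_forall fun r => .of_forall fun y => ?_) (integrable_const _) ?_
    · exact (norm_indicator_le_norm_self _ _).trans (by simp)
    · have h0 : ν (Metric.sphere (0 : 𝔼) r₀) = 0 :=
        le_antisymm (((Measure.restrict_apply_le _ _).trans (Measure.restrict_apply_le _ _)).trans
          (Measure.addHaar_sphere _ _ _).le) bot_le
      filter_upwards [measure_eq_zero_iff_ae_notMem.1 h0] with y hy
      rw [mem_sphere_zero_iff_norm] at hy
      rcases lt_or_gt_of_ne hy with h | h
      · refine (continuousAt_const (y := (1 : ℝ))).congr ?_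
        filter_upwards [lt_mem_nhds h] with r hr
        rw [indicator_of_mem (by simpa using hr.le)]
      · refine (continuousAt_const (y := (0 : ℝ))).congr ?_
        filter_upwards [gt_mem_nhds h] with r hr
        rw [indicator_of_notMem (by simpa using hr)]
  have hmem : m.toReal ∈ Icc (φ (-1)) (φ R) := by
    rw [hφr, hφr]
    constructor
    · rw [Metric.closedBall_eq_empty.2 (by norm_num)]
      simp
    · refine ENNReal.toReal_mono (measure_ne_top _ _) (hm.trans ?_)
      rw [Measure.restrict_apply measurableSet_closedBall, inter_comm]
      have h0 : (volume : Measure 𝔼).restrict Ω (Metric.closedBall 0 R)ᶜ = 0 := by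
        rw [Measure.restrict_apply measurableSet_closedBall.compl, inter_comm, ← sdiff_eq,
          sdiff_eq_empty.2 (hR.trans Metric.ball_subset_closedBall), measure_empty]
      exact (measure_inter_conull h0).ge
  obtain ⟨r, -, hr⟩ := intermediate_value_Icc (by linarith) hcont.continuousOn hmem
  refine ⟨H ∩ Metric.closedBall 0 r, inter_subset_left, hH.inter measurableSet_closedBall, ?_⟩
  rw [hφr, Measure.real, ENNReal.toReal_eq_toReal_iff' (measure_ne_top _ _)
    (ne_top_of_le_ne_top (measure_ne_top _ _) hm), Measure.restrict_apply
    measurableSet_closedBall] at hr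
  rw [inter_comm]
  exact hr

/-! ### From the kernel expansion to the Adams size conditions. -/

/-- Tangent-line bound for `x ↦ x ^ q`. -/
theorem rpow_le_rpow_add_of_le_add {q a b e M : ℝ} (hq : 1 ≤ q) (ha : 0 ≤ a) (hb : 0 ≤ b)
    (he : 0 ≤ e) (hab : a ≤ b + e) (haM : a ≤ M) : a ^ q ≤ b ^ q + q * M ^ (q - 1) * e := by
  have hM : 0 ≤ M := ha.trans haM
  have h0 : 0 ≤ q * M ^ (q - 1) * e := by positivity
  rcases le_total a b with h | h
  · have := Real.rpow_le_rpow ha h (by linarith : 0 ≤ q)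
    linarith
  rcases ha.eq_or_lt with h1 | ha'
  · rw [← h1, Real.zero_rpow (by linarith)]
    positivity
  have h2 := one_add_mul_self_le_rpow_one_add (s := b / a - 1)
    (by have : 0 ≤ b / a := by positivity
        linarith) hq
  rw [add_sub_cancel, Real.div_rpow hb ha, le_div_iff₀ (by positivity)] at h2
  have h3 : a ^ q = a ^ (q - 1) * a := by rw [← Real.rpow_add_one ha'.ne', sub_add_cancel]
  have h4 : (1 + q * (b / a - 1)) * a ^ q = a ^ q - q * a ^ (q - 1) * (a - b) := by
    rw [h3]; field_simp; ring
  have h5 : q * a ^ (q - 1) * (a - b) ≤ q * M ^ (q - 1) * e := by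
    have : a ^ (q - 1) ≤ M ^ (q - 1) := Real.rpow_le_rpow ha haM (by linarith)
    gcongr
    linarith
  linarith

theorem EReal.abs_toReal_sub_le {a : EReal} {b c : ℝ} (h : (a - (b : EReal)).abs ≤ ENNReal.ofReal c)
    (hc : 0 ≤ c) : |a.toReal - b| ≤ c := by
  induction a using EReal.rec with
  | bot => simp at h
  | top => simp at h
  | coe a =>
    rw [← EReal.coe_sub, EReal.abs_def, ENNReal.ofReal_le_ofReal_iff hc] at h
    simpa using h

theorem norm_inv_smul_mem_sphere {x y : 𝔼} (h : x ≠ y) :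
    ‖y - x‖⁻¹ • (y - x) ∈ Metric.sphere (0 : 𝔼) 1 := by
  rw [mem_sphere_zero_iff_norm, norm_smul, norm_inv, norm_norm,
    inv_mul_cancel₀ (norm_ne_zero_iff.2 (sub_ne_zero.2 h.symm))]

/-- Divided by |y-x|^{d-n}, both |K| and its leading term are bounded and differ by O(|y-x|^ε). The
tangent-line bound keeps that error after raising to the power q, and (d - n)q = -n turns the common
factor into |y-x|^{-n}. The upper estimate serves the inequality, the lower one sharpness. -/
theorem HasKernelExpansion.exists_bounds {Ω : Set 𝔼} {K : 𝔼 → 𝔼 → EReal} {g : 𝔼 → 𝔼 → ℝ}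
    {d ε q : ℝ} (hK : HasKernelExpansion Ω K g d ε) (hΩ : Bornology.IsBounded Ω) (hε : 0 < ε)
    (hq : 1 ≤ q) (hdq : (d - n) * q = -n)
    (hgb : ∃ M : ℝ, ∀ x ∈ Ω, ∀ ω ∈ Metric.sphere (0 : 𝔼) 1, |g x ω| ≤ M) :
    ∃ C : ℝ, 0 < C ∧ ∀ x ∈ Ω, ∀ y ∈ Ω, x ≠ y →
      |(K x y).toReal| ≤ C * ‖y - x‖ ^ (d - n) ∧
      |(K x y).toReal| ^ q ≤ ‖y - x‖ ^ (-n : ℝ) * |g x (‖y - x‖⁻¹ • (y - x))| ^ q +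
        C * ‖y - x‖ ^ (ε - n) ∧
      ‖y - x‖ ^ (-n : ℝ) * |g x (‖y - x‖⁻¹ • (y - x))| ^ q ≤ |(K x y).toReal| ^ q +
        C * ‖y - x‖ ^ (ε - n) ∧
      |(K x y).toReal - g x (‖y - x‖⁻¹ • (y - x)) * ‖y - x‖ ^ (d - n)| ≤
        C * ‖y - x‖ ^ (d - n + ε) := by
  obtain ⟨C', hC'⟩ := hK
  obtain ⟨M', hM'⟩ := hgb
  obtain ⟨R, hR⟩ := hΩ.exists_norm_le
  set C₁ := max C' 1 with hC₁
  set M := max M' 1 with hM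
  set R₁ := 2 * max R 1 with hR₁
  have hC₁0 : 0 < C₁ := by positivity
  have hM0 : 0 < M := by positivity
  have hR₁0 : 0 < R₁ := by positivity
  set N := M + C₁ * R₁ ^ ε with hN
  have hN0 : 0 < N := by positivity
  have hq0 : 0 < q := by linarith
  refine ⟨C₁ + N + q * N ^ (q - 1) * C₁, by positivity, fun x hx y hy hxy => ?_⟩
  set s := ‖y - x‖ with hs
  have hs0 : 0 < s := norm_pos_iff.2 (sub_ne_zero.2 hxy.symm)
  have hsR : s ≤ R₁ := by
    have := norm_sub_le y x
    have := hR x hx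
    have := hR y hy
    have := le_max_left R 1
    linarith
  set ω := s⁻¹ • (y - x) with hω
  have hgM : |g x ω| ≤ M := (hM' x hx ω (norm_inv_smul_mem_sphere hxy)).trans (le_max_left _ _)
  have hdiff : |(K x y).toReal - g x ω * s ^ (d - n)| ≤ C₁ * s ^ (d - n + ε) := by
    have h1 := hC' x hx y hy hxy
    rw [norm_sub_rev x y] at h1
    refine EReal.abs_toReal_sub_le (h1.trans (ENNReal.ofReal_le_ofReal ?_)) (by positivity)
    gcongr
    exact le_max_left _ _
  set a := |(K x y).toReal| with ha
  set b := s ^ (d - n) with hb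
  have hb0 : 0 < b := by positivity
  have hbε : s ^ (d - n + ε) = b * s ^ ε := Real.rpow_add hs0 _ _
  have hbq : b ^ q = s ^ (-n : ℝ) := by rw [hb, ← Real.rpow_mul hs0.le, hdq]
  have hsε : s ^ ε ≤ R₁ ^ ε := by gcongr
  have hab1 : a ≤ b * (|g x ω| + C₁ * s ^ ε) := by
    have h1 := abs_sub_abs_le_abs_sub (K x y).toReal (g x ω * b)
    rw [abs_mul, abs_of_pos hb0] at h1
    rw [hbε] at hdiff
    linarith
  have hab2 : b * |g x ω| ≤ a + b * (C₁ * s ^ ε) := by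
    have h1 := abs_sub_abs_le_abs_sub (g x ω * b) (K x y).toReal
    rw [abs_mul, abs_of_pos hb0, abs_sub_comm] at h1
    rw [hbε] at hdiff
    linarith
  have hεn : s ^ (ε - n) = s ^ (-n : ℝ) * s ^ ε := by rw [← Real.rpow_add hs0]; ring_nf
  have haN : a / b ≤ N := by
    rw [div_le_iff₀ hb0, mul_comm]
    refine hab1.trans ?_
    gcongr
    rw [hN]
    gcongr
  have hgN : |g x ω| ≤ N := by
    have : 0 ≤ C₁ * R₁ ^ ε := by positivity
    linarith
  have haq : a ^ q = s ^ (-n : ℝ) * (a / b) ^ q := by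
    rw [Real.div_rpow (by positivity) hb0.le, hbq, mul_div_cancel₀]
    positivity
  have hcoef : q * N ^ (q - 1) * (C₁ * s ^ ε) ≤ (C₁ + N + q * N ^ (q - 1) * C₁) * s ^ ε := by
    have h1 : 0 ≤ (C₁ + N) * s ^ ε := by positivity
    linarith
  have hsn : 0 < s ^ (-n : ℝ) := by positivity
  refine ⟨?_, ?_, ?_, hdiff.trans ?_⟩
  · rw [div_le_iff₀ hb0] at haN
    refine haN.trans ?_
    gcongr
    have : 0 ≤ q * N ^ (q - 1) * C₁ := by positivity
    linarith
  · have h1 : a / b ≤ |g x ω| + C₁ * s ^ ε := by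
      rw [div_le_iff₀ hb0]; linarith
    have h2 := rpow_le_rpow_add_of_le_add hq (by positivity) (abs_nonneg _) (by positivity) h1 haN
    rw [haq, hεn]
    have h3 := mul_le_mul_of_nonneg_left (h2.trans (add_le_add_right hcoef _)) hsn.le
    linarith
  · have h1 : |g x ω| ≤ a / b + C₁ * s ^ ε := by
      have : a / b * b = a := div_mul_cancel₀ _ hb0.ne'
      refine le_of_mul_le_mul_left ?_ hb0
      linarith
    have h2 := rpow_le_rpow_add_of_le_add hq (abs_nonneg _) (by positivity) (by positivity) h1 hgN
    rw [haq, hεn]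
    have h3 := mul_le_mul_of_nonneg_left (h2.trans (add_le_add_right hcoef _)) hsn.le
    linarith
  · gcongr
    have : 0 ≤ q * N ^ (q - 1) * C₁ := by positivity
    linarith

theorem sphericalIntegral_nonneg (g : 𝔼 → 𝔼 → ℝ) (q : ℝ) (x : 𝔼) :
    0 ≤ sphericalIntegral g q x :=
  integral_nonneg fun _ => by positivity

theorem ofReal_sphericalIntegral {g : 𝔼 → 𝔼 → ℝ} {q : ℝ} (hq : 0 ≤ q) {x : 𝔼}
    (hgs : AEMeasurable (fun ω : Metric.sphere (0 : 𝔼) 1 => g x ω)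
      (volume : Measure 𝔼).toSphere) {M : ℝ}
    (hM : ∀ ω ∈ Metric.sphere (0 : 𝔼) 1, |g x ω| ≤ M) :
    ENNReal.ofReal (sphericalIntegral g q x) =
      ∫⁻ ω : Metric.sphere (0 : 𝔼) 1, ENNReal.ofReal (|g x ω| ^ q)
        ∂(volume : Measure 𝔼).toSphere := by
  refine ofReal_integral_eq_lintegral_ofReal ?_ (.of_forall fun ω => by positivity)
  refine Integrable.of_bound (C := M ^ q)
    ((continuous_abs.measurable.comp_aemeasurable hgs).pow_const q).aestronglyMeasurable
    (.of_forall fun ω => ?_)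
  rw [Real.norm_of_nonneg (by positivity)]
  exact Real.rpow_le_rpow (abs_nonneg _) (hM ω ω.2) hq

theorem sphericalIntegral_le {Ω : Set 𝔼} (hn : 0 < n) {g : 𝔼 → 𝔼 → ℝ} {q : ℝ} (hq : 0 ≤ q)
    (hgb : ∃ M : ℝ, ∀ x ∈ Ω, ∀ ω ∈ Metric.sphere (0 : 𝔼) 1, |g x ω| ≤ M) {x : 𝔼} (hx : x ∈ Ω) :
    sphericalIntegral g q x ≤ n * adamsA Ω g q := by
  have hn' : (0 : ℝ) < n := by exact_mod_cast hn
  rw [adamsA, ← mul_assoc, mul_one_div_cancel hn'.ne', one_mul]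
  obtain ⟨M, hM⟩ := hgb
  refine le_csSup ⟨M ^ q * (volume : Measure 𝔼).toSphere.real univ, ?_⟩ (mem_image_of_mem _ hx)
  rintro _ ⟨z, hz, rfl⟩
  refine (Real.le_norm_self _).trans
    (norm_integral_le_of_norm_le_const (C := M ^ q) (.of_forall fun ω => ?_))
  rw [Real.norm_of_nonneg (by positivity)]
  exact Real.rpow_le_rpow (abs_nonneg _) (hM z hz ω ω.2) hq

/-- The surface measure of the unit sphere. -/
noncomputable def sphereArea (n : ℕ) : ℝ := (volume : Measure (EuclideanSpace ℝ (Fin n))).toSphere.real univ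

theorem sphereArea_nonneg : 0 ≤ sphereArea n := measureReal_nonneg

theorem ofReal_sphereArea :
    ENNReal.ofReal (sphereArea n) = (volume : Measure 𝔼).toSphere univ := by
  rw [sphereArea, ofReal_measureReal]

theorem setLIntegral_ball_le_of_le_rpow (hn : 0 < n) {Ω : Set 𝔼} (hΩ : MeasurableSet Ω) {x : 𝔼}
    {h : 𝔼 → ℝ≥0∞} {a c r : ℝ} (ha : 0 < a) (hc : 0 ≤ c) (hr : 0 ≤ r)
    (hh : ∀ y ∈ Ω, y ≠ x → h y ≤ ENNReal.ofReal (c * ‖y - x‖ ^ (a - n))) :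
    ∫⁻ y in Metric.ball x r, h y ∂((volume : Measure 𝔼).restrict Ω) ≤
      ENNReal.ofReal (c * (sphereArea n * (r ^ a / a))) := by
  have : Nonempty (Fin n) := ⟨⟨0, hn⟩⟩
  have hne : ∀ᵐ y ∂(volume : Measure 𝔼), y ≠ x := compl_mem_ae_iff.2 (measure_singleton x)
  calc ∫⁻ y in Metric.ball x r, h y ∂((volume : Measure 𝔼).restrict Ω)
      ≤ ∫⁻ y in Metric.ball x r, ENNReal.ofReal c * ENNReal.ofReal (‖y - x‖ ^ (a - n))
          ∂((volume : Measure 𝔼).restrict Ω) := by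
        refine lintegral_mono_ae (ae_restrict_of_ae ?_)
        filter_upwards [ae_restrict_mem hΩ, ae_restrict_of_ae hne] with y hy hyx
        rw [← ENNReal.ofReal_mul hc]
        exact hh y hy hyx
    _ ≤ ∫⁻ y in Metric.ball x r, ENNReal.ofReal c * ENNReal.ofReal (‖y - x‖ ^ (a - n)) :=
        lintegral_mono' (Measure.restrict_mono_measure Measure.restrict_le_self _) le_rfl
    _ = _ := by
        rw [lintegral_const_mul _ (by fun_prop), lintegral_ball_rpow hn x hr ha,
          ← ofReal_sphereArea, ← ENNReal.ofReal_mul sphereArea_nonneg, ← ENNReal.ofReal_mul hc]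

theorem setLIntegral_sdiff_ball_le_of_le_rpow {ν : Measure 𝔼} {Ω : Set 𝔼}
    (hν : ∀ᵐ y ∂ν, y ∈ Ω) {x : 𝔼} {h : 𝔼 → ℝ≥0∞} {a c r : ℝ} (ha : a ≤ 0) (hc : 0 ≤ c)
    (hr : 0 < r) (hh : ∀ y ∈ Ω, y ≠ x → h y ≤ ENNReal.ofReal (c * ‖y - x‖ ^ a)) {G : Set 𝔼}
    (hG : MeasurableSet G) :
    ∫⁻ y in G \ Metric.ball x r, h y ∂ν ≤ ENNReal.ofReal (c * r ^ a) * ν G := by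
  calc ∫⁻ y in G \ Metric.ball x r, h y ∂ν
      ≤ ∫⁻ _ in G \ Metric.ball x r, ENNReal.ofReal (c * r ^ a) ∂ν := by
        refine setLIntegral_mono_ae' (hG.diff measurableSet_ball) ?_
        filter_upwards [hν] with y hy hyG
        have hyr : r ≤ ‖y - x‖ := by simpa [dist_eq_norm] using hyG.2
        refine (hh y hy ?_).trans (ENNReal.ofReal_le_ofReal ?_)
        · rintro rfl
          simp at hyr
          linarith
        · gcongr ?_ * ?_
          exact Real.rpow_le_rpow_of_nonpos hr hyr ha
    _ = ENNReal.ofReal (c * r ^ a) * ν (G \ Metric.ball x r) := setLIntegral_const _ _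
    _ ≤ _ := by
        gcongr
        exact sdiff_subset

/-- At the radius v^{1/n}, a set of measure v lying outside the ball contributes the same order
v^{d/n} as the ball itself; the case d = 0 is used for |K|^q. -/
theorem rpow_one_div_rpow_mul {v d : ℝ} (hv : 0 < v) (hn : (0 : ℝ) < n) :
    (v ^ (1 / (n : ℝ))) ^ (d - n) * v = v ^ (d / n) := by
  nth_rewrite 2 [← Real.rpow_one v]
  rw [← Real.rpow_mul hv.le, ← Real.rpow_add hv]
  congr 1
  field_simp
  ring

/-- For rows, the excluded set is the ball about x of radius r = m^{1/n}, and G is cut again at R =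
ν(G)^{1/n}. The annulus gives at most nA log(R/r) = A log(ν(G)/m), plus the integrable error; beyond
R, |K|^q ≲ R^{-n} on a set of measure R^n is O(1). The ball contributes order r^d = m^{1/p}. Columns
are split at the radius ν(E)^{1/n}. -/
theorem HasKernelExpansion.isAdamsKernel {d p q ε : ℝ} (hd : 0 < d) (hdn : d < n) (hp : p = n / d)
    (hq : 1 ≤ q) (hdq : (d - n) * q = -n) (hε : 0 < ε) {Ω : Set 𝔼} (hΩm : MeasurableSet Ω)
    (hΩb : Bornology.IsBounded Ω) {K : 𝔼 → 𝔼 → EReal}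
    (hKm : AEMeasurable (fun z : 𝔼 × 𝔼 => K z.1 z.2) (volume.restrict (Ω ×ˢ Ω)))
    {g : 𝔼 → 𝔼 → ℝ}
    (hgs : ∀ x ∈ Ω, AEMeasurable (fun ω : Metric.sphere (0 : 𝔼) 1 => g x ω)
      (volume : Measure 𝔼).toSphere)
    (hgb : ∃ M : ℝ, ∀ x ∈ Ω, ∀ ω ∈ Metric.sphere (0 : 𝔼) 1, |g x ω| ≤ M)
    (hK : HasKernelExpansion Ω K g d ε) (hA : 0 < adamsA Ω g q) :
    ∃ C : ℝ, IsAdamsKernel (volume.restrict Ω) (fun x y => ENNReal.ofReal |(K x y).toReal|) p q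
      (adamsA Ω g q) C := by
  have hn' : (0 : ℝ) < n := hd.trans hdn
  have hn : 0 < n := by exact_mod_cast hn'
  have hq0 : 0 ≤ q := by linarith
  have hpd : 1 / p = d / n := by rw [hp, one_div_div]
  have : IsFiniteMeasure ((volume : Measure 𝔼).restrict Ω) :=
    isFiniteMeasure_restrict.2 hΩb.measure_lt_top.ne
  obtain ⟨c, hc, hb⟩ := hK.exists_bounds hΩb hε hq hdq hgb
  obtain ⟨R₀, hR₀⟩ := hΩb.exists_norm_le
  set R₁ := 2 * max R₀ 1 + 1 with hR₁
  have hR₁0 : 0 < R₁ := by positivity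
  have hΩR : ∀ x ∈ Ω, Ω ⊆ Metric.ball x R₁ := fun x hx y hy => by
    rw [mem_ball_iff_norm]
    have := norm_sub_le y x
    have := hR₀ x hx
    have := hR₀ y hy
    have := le_max_left R₀ 1
    linarith
  have hS : 0 ≤ sphereArea n := sphereArea_nonneg
  set c₁ := c * (sphereArea n * (R₁ ^ ε / ε)) with hc₁
  set c₂ := c ^ q with hc₂
  set c₃ := c * (sphereArea n / d) with hc₃
  have hc₁0 : 0 ≤ c₁ := by positivity
  have hc₂0 : 0 ≤ c₂ := by positivity
  have hc₃0 : 0 ≤ c₃ := by positivity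
  set ν := (volume : Measure 𝔼).restrict Ω with hν
  have hνΩ : ∀ᵐ y ∂ν, y ∈ Ω := ae_restrict_mem hΩm
  have hball : ∀ x : 𝔼, ∀ h : 𝔼 → ℝ≥0∞,
      (∀ y ∈ Ω, y ≠ x → h y ≤ ENNReal.ofReal (c * ‖y - x‖ ^ (d - n))) → ∀ v : ℝ, 0 < v →
      ∫⁻ y in Metric.ball x (v ^ (1 / (n : ℝ))), h y ∂ν ≤ ENNReal.ofReal (c₃ * v ^ (d / n)) := by
    intro x h hh v hv
    refine (setLIntegral_ball_le_of_le_rpow hn hΩm hd hc.le (by positivity) hh).trans_eq ?_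
    rw [← Real.rpow_mul hv.le, hc₃]
    congr 1
    rw [one_div_mul_eq_div]
    ring
  refine ⟨c₁ + c₂ + c₃ + c, by positivity, ?_, ?_, ?_⟩
  · rw [hν, Measure.prod_restrict]
    exact (continuous_abs.measurable.comp_aemeasurable
      (measurable_ereal_toReal.comp_aemeasurable hKm)).ennreal_ofReal
  · filter_upwards [hνΩ] with x hx G hG m hm0 hmG
    have hmt : m ≠ ⊤ := ne_top_of_le_ne_top (measure_ne_top _ _) hmG
    have hm' : 0 < m.toReal := ENNReal.toReal_pos hm0.ne' hmt
    have hG' : m.toReal ≤ (ν G).toReal := ENNReal.toReal_mono (measure_ne_top _ _) hmG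
    have hG0 : 0 < (ν G).toReal := hm'.trans_le hG'
    set r := m.toReal ^ (1 / (n : ℝ)) with hr
    set R := (ν G).toReal ^ (1 / (n : ℝ)) with hR
    have hr0 : 0 < r := by positivity
    have hrR : r ≤ R := by simp only [hr, hR]; gcongr
    refine ⟨Metric.ball x r, measurableSet_ball, ?_, ?_⟩
    · have hsub : G \ Metric.ball x r ⊆
          (Metric.ball x R \ Metric.ball x r) ∪ (G \ Metric.ball x R) := fun y hy => by
        by_cases h : y ∈ Metric.ball x R
        · exact Or.inl ⟨h, hy.2⟩
        · exact Or.inr ⟨hy.1, h⟩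
      have hfar : ∫⁻ y in G \ Metric.ball x R, ENNReal.ofReal |(K x y).toReal| ^ q ∂ν ≤
          ENNReal.ofReal c₂ := by
        have h1 := setLIntegral_sdiff_ball_le_of_le_rpow (x := x) hνΩ
          (h := fun y => ENNReal.ofReal |(K x y).toReal| ^ q)
          (by linarith : (-n : ℝ) ≤ 0) hc₂0 (hr0.trans_le hrR) (fun y hy hyx => by
            have h2 := (hb x hx y hy hyx.symm).1
            rw [ENNReal.ofReal_rpow_of_nonneg (abs_nonneg _) hq0]
            refine ENNReal.ofReal_le_ofReal ((Real.rpow_le_rpow (abs_nonneg _) h2 hq0).trans_eq ?_)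
            rw [Real.mul_rpow hc.le (by positivity), ← Real.rpow_mul (norm_nonneg _), hdq]) hG
        refine h1.trans_eq ?_
        rw [← ENNReal.ofReal_toReal (measure_ne_top ν G), ← ENNReal.ofReal_mul (by positivity),
          mul_assoc]
        have h3 := rpow_one_div_rpow_mul (n := n) (d := 0) hG0 hn'
        rw [zero_sub, zero_div, Real.rpow_zero] at h3
        rw [← hR] at h3
        rw [h3, mul_one]
      have hann : ∫⁻ y in Metric.ball x R \ Metric.ball x r,
          ENNReal.ofReal |(K x y).toReal| ^ q ∂ν ≤
          ENNReal.ofReal (adamsA Ω g q * Real.log (ν G / m).toReal) + ENNReal.ofReal c₁ := by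
        set G₀ : 𝔼 → ℝ≥0∞ := fun ω => ENNReal.ofReal (|g x ω| ^ q) with hG₀
        have hG₀m : AEMeasurable (fun ω : Metric.sphere (0 : 𝔼) 1 => G₀ ω)
            (volume : Measure 𝔼).toSphere :=
          ((continuous_abs.measurable.comp_aemeasurable (hgs x hx)).pow_const q).ennreal_ofReal
        calc ∫⁻ y in Metric.ball x R \ Metric.ball x r, ENNReal.ofReal |(K x y).toReal| ^ q ∂ν
            ≤ ∫⁻ y in Metric.ball x R \ Metric.ball x r,
              (ENNReal.ofReal (‖y - x‖ ^ (-n : ℝ)) * G₀ (‖y - x‖⁻¹ • (y - x)) +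
                ENNReal.ofReal (c * ‖y - x‖ ^ (ε - n))) ∂ν := by
              refine setLIntegral_mono_ae' (measurableSet_ball.diff measurableSet_ball) ?_
              filter_upwards [hνΩ] with y hy hyr
              have hyx : x ≠ y := by
                rintro rfl
                exact hyr.2 (Metric.mem_ball_self hr0)
              simp only [hG₀]
              rw [ENNReal.ofReal_rpow_of_nonneg (abs_nonneg _) hq0,
                ← ENNReal.ofReal_mul (by positivity),
                ← ENNReal.ofReal_add (by positivity) (by positivity)]
              exact ENNReal.ofReal_le_ofReal (hb x hx y hy hyx).2.1
          _ = ∫⁻ y in Metric.ball x R \ Metric.ball x r,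
                ENNReal.ofReal (‖y - x‖ ^ (-n : ℝ)) * G₀ (‖y - x‖⁻¹ • (y - x)) ∂ν +
              ∫⁻ y in Metric.ball x R \ Metric.ball x r,
                ENNReal.ofReal (c * ‖y - x‖ ^ (ε - n)) ∂ν :=
              lintegral_add_right _ (by fun_prop)
          _ ≤ (∫⁻ y in Metric.ball x R \ Metric.ball x r,
                ENNReal.ofReal (‖y - x‖ ^ (-n : ℝ)) * G₀ (‖y - x‖⁻¹ • (y - x))) +
              ∫⁻ y in Metric.ball x R₁, ENNReal.ofReal (c * ‖y - x‖ ^ (ε - n)) ∂ν := by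
              refine add_le_add (lintegral_mono' (Measure.restrict_mono_measure
                Measure.restrict_le_self _) le_rfl) ?_
              refine (setLIntegral_le_lintegral _ _).trans ?_
              rw [Measure.restrict_eq_self_of_ae_mem (hνΩ.mono (hΩR x hx))]
          _ ≤ _ := by
              refine add_le_add ?_ (setLIntegral_ball_le_of_le_rpow hn hΩm hε hc.le hR₁0.le
                fun y _ _ => le_rfl)
              obtain ⟨M, hM⟩ := hgb
              rw [lintegral_annulus hn x hr0 hrR hG₀m,
                ← ofReal_sphericalIntegral hq0 (hgs x hx) (hM x hx),
                ← ENNReal.ofReal_mul (sphericalIntegral_nonneg g q x)]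
              have hlog : Real.log (R / r) = 1 / n * Real.log (ν G / m).toReal := by
                rw [hR, hr, ← Real.div_rpow hG0.le hm'.le, Real.log_rpow (by positivity),
                  ENNReal.toReal_div]
              have hlog0 : 0 ≤ Real.log (R / r) :=
                Real.log_nonneg ((one_le_div hr0).2 hrR)
              refine ENNReal.ofReal_le_ofReal ?_
              calc sphericalIntegral g q x * Real.log (R / r)
                  ≤ n * adamsA Ω g q * Real.log (R / r) := by
                    gcongr
                    exact sphericalIntegral_le hn hq0 ⟨M, hM⟩ hx
                _ = _ := by rw [hlog]; field_simp
      refine (lintegral_mono_set hsub).trans ((lintegral_union_le _ _ _).trans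
        ((add_le_add hann hfar).trans ?_))
      have hlog0 : 0 ≤ Real.log (ν G / m).toReal := by
        rw [ENNReal.toReal_div]
        exact Real.log_nonneg ((one_le_div hm').2 hG')
      rw [← ENNReal.ofReal_add (by positivity) hc₁0, ← ENNReal.ofReal_add (by positivity) hc₂0]
      exact ENNReal.ofReal_le_ofReal (by linarith)
    · refine (hball x _ (fun y hy hyx => ENNReal.ofReal_le_ofReal
        (hb x hx y hy hyx.symm).1) _ hm').trans ?_
      rw [ENNReal.ofReal_mul hc₃0, ← ENNReal.ofReal_rpow_of_pos hm', ENNReal.ofReal_toReal hmt, hpd]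
      gcongr
      linarith
  · filter_upwards [hνΩ] with y hy E hE
    rcases eq_or_ne (ν E) 0 with h0 | h0
    · rw [Measure.restrict_eq_zero.2 h0]; simp
    have hv : 0 < (ν E).toReal := ENNReal.toReal_pos h0 (measure_ne_top _ _)
    set r := (ν E).toReal ^ (1 / (n : ℝ)) with hr
    have hh : ∀ x ∈ Ω, x ≠ y → ENNReal.ofReal |(K x y).toReal| ≤
        ENNReal.ofReal (c * ‖x - y‖ ^ (d - n)) := fun x hx hxy => by
      rw [norm_sub_rev]
      exact ENNReal.ofReal_le_ofReal (hb x hx y hy hxy).1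
    have h1 := hball y _ hh _ hv
    have h2 := setLIntegral_sdiff_ball_le_of_le_rpow hνΩ (by linarith : d - n ≤ 0) hc.le
      (by positivity : 0 < r) hh hE
    have h3 : ENNReal.ofReal (c * r ^ (d - n)) * ν E =
        ENNReal.ofReal (c * (ν E).toReal ^ (d / n)) := by
      nth_rewrite 1 [← ENNReal.ofReal_toReal (measure_ne_top ν E)]
      rw [← ENNReal.ofReal_mul (by positivity), mul_assoc, hr, rpow_one_div_rpow_mul hv hn']
    calc ∫⁻ x in E, ENNReal.ofReal |(K x y).toReal| ∂ν
        ≤ ∫⁻ x in Metric.ball y r ∪ (E \ Metric.ball y r), ENNReal.ofReal |(K x y).toReal| ∂ν := by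
          refine lintegral_mono_set fun x hx => ?_
          by_cases h : x ∈ Metric.ball y r
          · exact Or.inl h
          · exact Or.inr ⟨hx, h⟩
      _ ≤ ENNReal.ofReal (c₃ * (ν E).toReal ^ (d / n)) +
          ENNReal.ofReal (c * (ν E).toReal ^ (d / n)) :=
          (lintegral_union_le _ _ _).trans (add_le_add h1 (h2.trans_eq h3))
      _ = ENNReal.ofReal (c₃ + c) * ν E ^ (1 / p) := by
          rw [← ENNReal.ofReal_add (by positivity) (by positivity), ← add_mul,
            ENNReal.ofReal_mul (by positivity), ← ENNReal.ofReal_rpow_of_pos hv,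
            ENNReal.ofReal_toReal (measure_ne_top _ _), hpd]
      _ ≤ _ := by
          gcongr
          linarith

/-! ### Passage to signed kernels and functions in L^p. -/

section Potential

variable {X : Type*} [MeasurableSpace X] {ν : Measure X} [IsFiniteMeasure ν] {κ : X → X → ℝ}
  {p q A C : ℝ}

/-- The averaged bound with both sets equal to the whole space. Fubini then yields absolute
convergence almost everywhere and measurability of the potential. -/
theorem IsAdamsKernel.integrable_mul
    (hk : IsAdamsKernel ν (fun x y => ENNReal.ofReal |κ x y|) p q A C)
    (hκ : AEMeasurable (fun z : X × X => κ z.1 z.2) (ν.prod ν))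
    (hpq : p.HolderConjugate q) {f : X → ℝ} (hf : MemLp f (ENNReal.ofReal p) ν) :
    Integrable (fun z : X × X => κ z.1 z.2 * f z.2) (ν.prod ν) := by
  have hp := hpq.pos
  have hm : AEStronglyMeasurable (fun z : X × X => κ z.1 z.2 * f z.2) (ν.prod ν) :=
    hκ.aestronglyMeasurable.mul hf.1.comp_snd
  refine ⟨hm, ?_⟩
  have hfp : ∫⁻ y, ‖hf.1.mk f y‖ₑ ^ p ∂ν ≠ ⊤ := by
    have h1 := (lintegral_rpow_enorm_lt_top_of_eLpNorm_lt_top (by simpa using hp)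
      ENNReal.ofReal_ne_top hf.2).ne
    rw [ENNReal.toReal_ofReal hp.le] at h1
    rwa [lintegral_congr_ae (g := fun y => ‖f y‖ₑ ^ p)]
    filter_upwards [hf.1.ae_eq_mk] with y hy
    rw [hy]
  have h1 := hk.lintegral_lintegral_le hpq (f := fun y => ‖hf.1.mk f y‖ₑ)
    hf.1.stronglyMeasurable_mk.measurable.enorm (E := univ) (F := univ) MeasurableSet.univ le_rfl
  rw [hasFiniteIntegral_iff_enorm, lintegral_prod _ hm.enorm]
  simp only [Measure.restrict_univ] at h1
  refine (le_of_eq_of_le ?_ h1).trans_lt ?_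
  · refine lintegral_congr fun x => lintegral_congr_ae ?_
    filter_upwards [hf.1.ae_eq_mk] with y hy
    rw [enorm_mul, hy, Real.enorm_eq_ofReal_abs (κ x y)]
  · exact ENNReal.mul_lt_top (ENNReal.mul_lt_top ENNReal.ofReal_lt_top
      (ENNReal.rpow_lt_top_of_nonneg (by positivity) hfp)) (measure_lt_top _ _)

theorem IsAdamsKernel.exists_lintegral_exp_abs_integral_le (hν : HasIntermediateSubsets ν)
    (hk : IsAdamsKernel ν (fun x y => ENNReal.ofReal |κ x y|) p q A C)
    (hκ : AEMeasurable (fun z : X × X => κ z.1 z.2) (ν.prod ν))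
    (hpq : p.HolderConjugate q) (hA : 0 < A) :
    ∃ C' : ℝ, 0 < C' ∧ ∀ f : X → ℝ, MemLp f (ENNReal.ofReal p) ν →
      ∫⁻ x, ENNReal.ofReal (Real.exp (A⁻¹ * (|∫ y, κ x y * f y ∂ν| /
        (eLpNorm f (ENNReal.ofReal p) ν).toReal) ^ q)) ∂ν ≤ ENNReal.ofReal C' := by
  have hp := hpq.pos
  have hq := hpq.symm.pos
  obtain ⟨C', hC', h⟩ := hk.lintegral_exp_le hν hpq hA
  refine ⟨C' + (ν univ).toReal, by positivity, fun f hf => ?_⟩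
  set L := (eLpNorm f (ENNReal.ofReal p) ν).toReal with hL
  -- Division by zero returns 0, so the integrand is 1; this is why ν(X) is added to the constant.
  rcases eq_or_ne L 0 with hL0 | hL0
  · simp only [hL0, div_zero, Real.zero_rpow hq.ne', mul_zero, Real.exp_zero, ENNReal.ofReal_one,
      lintegral_one]
    exact (ENNReal.ofReal_toReal (measure_ne_top ν univ)).symm.trans_le
      (ENNReal.ofReal_le_ofReal (by linarith))
  have hLpos : 0 < L := lt_of_le_of_ne ENNReal.toReal_nonneg hL0.symm
  set F : X → ℝ≥0∞ := fun y => ‖hf.1.mk f y‖ₑ * ENNReal.ofReal L⁻¹ with hF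
  have hFm : Measurable F := hf.1.stronglyMeasurable_mk.measurable.enorm.mul_const _
  have hFp : ∫⁻ y, F y ^ p ∂ν ≤ 1 := by
    have h1 : ∫⁻ y, F y ^ p ∂ν = (∫⁻ y, ‖f y‖ₑ ^ p ∂ν) * ENNReal.ofReal L⁻¹ ^ p := by
      rw [← lintegral_mul_const'' _ (hf.1.enorm.pow_const p)]
      refine lintegral_congr_ae ?_
      filter_upwards [hf.1.ae_eq_mk] with y hy
      simp only [hF]
      rw [ENNReal.mul_rpow_of_nonneg _ _ hp.le, hy]
    have h2 : ∫⁻ y, ‖f y‖ₑ ^ p ∂ν = ENNReal.ofReal L ^ p := by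
      rw [hL, ENNReal.ofReal_toReal hf.2.ne, eLpNorm_eq_lintegral_rpow_enorm_toReal
        (by simpa using hp) ENNReal.ofReal_ne_top, ENNReal.toReal_ofReal hp.le,
        ← ENNReal.rpow_mul, one_div_mul_cancel hp.ne', ENNReal.rpow_one]
    rw [h1, h2, ← ENNReal.mul_rpow_of_nonneg _ _ hp.le, ← ENNReal.ofReal_mul hLpos.le,
      mul_inv_cancel₀ hL0, ENNReal.ofReal_one, ENNReal.one_rpow]
  refine (lintegral_mono_ae ?_).trans ((h F hFm hFp).trans
    (ENNReal.ofReal_le_ofReal (by linarith [ENNReal.toReal_nonneg (a := ν univ)])))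
  filter_upwards [(hk.integrable_mul hκ hpq hf).prod_right_ae] with x hx
  have h1 : ∫⁻ y, ENNReal.ofReal |κ x y| * F y ∂ν =
      (∫⁻ y, ‖κ x y * f y‖ₑ ∂ν) * ENNReal.ofReal L⁻¹ := by
    rw [← lintegral_mul_const'' _ hx.1.enorm]
    refine lintegral_congr_ae ?_
    filter_upwards [hf.1.ae_eq_mk] with y hy
    simp only [hF]
    rw [enorm_mul, hy, Real.enorm_eq_ofReal_abs (κ x y), mul_assoc]
  have h2 : |∫ y, κ x y * f y ∂ν| / L ≤ (∫⁻ y, ENNReal.ofReal |κ x y| * F y ∂ν).toReal := by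
    rw [h1, ENNReal.toReal_mul, ENNReal.toReal_ofReal (by positivity), ← div_eq_mul_inv]
    gcongr
    have h3 := enorm_integral_le_lintegral_enorm (μ := ν) fun y => κ x y * f y
    have h4 := ENNReal.toReal_mono hx.2.ne h3
    rwa [toReal_enorm, Real.norm_eq_abs] at h4
  gcongr

end Potential

/-! ### Sharpness: the truncated kernels as test functions. -/

theorem norm_inv_norm_smul_sub_le {E : Type*} [NormedAddCommGroup E] [NormedSpace ℝ E] {u v : E}
    (hu : u ≠ 0) (hv : v ≠ 0) : ‖‖u‖⁻¹ • u - ‖v‖⁻¹ • v‖ ≤ 2 * ‖u - v‖ / ‖v‖ := by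
  have hu' := norm_pos_iff.2 hu
  have hv' := norm_pos_iff.2 hv
  have h1 : ‖u‖⁻¹ • u - ‖v‖⁻¹ • v = (‖u‖⁻¹ - ‖v‖⁻¹) • u + ‖v‖⁻¹ • (u - v) := by
    rw [sub_smul, smul_sub]; abel
  have h2 : ‖(‖u‖⁻¹ - ‖v‖⁻¹) • u‖ ≤ ‖u - v‖ / ‖v‖ := by
    have h3 : (‖u‖⁻¹ - ‖v‖⁻¹) * ‖u‖ = (‖v‖ - ‖u‖) / ‖v‖ := by field_simp
    calc ‖(‖u‖⁻¹ - ‖v‖⁻¹) • u‖ = |(‖u‖⁻¹ - ‖v‖⁻¹) * ‖u‖| := by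
          rw [norm_smul, abs_mul, abs_norm, Real.norm_eq_abs]
      _ = |‖v‖ - ‖u‖| / ‖v‖ := by rw [h3, abs_div, abs_norm]
      _ ≤ _ := by
        gcongr
        rw [abs_sub_comm]
        exact abs_norm_sub_norm_le u v
  have h4 : ‖‖v‖⁻¹ • (u - v)‖ = ‖u - v‖ / ‖v‖ := by
    rw [norm_smul, norm_inv, norm_norm, inv_mul_eq_div]
  rw [h1]
  refine (norm_add_le _ _).trans ?_
  rw [h4, mul_div_assoc]
  linarith

/-- Mean value inequality on [1/2, ∞). It is applied to t = |y-x|/|y-x₀|, which is at least 1/2 when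
|x-x₀| ≤ r/2 and |y-x₀| ≥ r. -/
theorem abs_rpow_neg_sub_one_le {a t : ℝ} (ha : 0 ≤ a) (ht : 1 / 2 ≤ t) :
    |t ^ (-a) - 1| ≤ a * 2 ^ (a + 1) * |t - 1| := by
  have hpos : ∀ u ∈ Ici (1 / 2 : ℝ), 0 < u := fun u hu =>
    lt_of_lt_of_le (by norm_num : (0 : ℝ) < 1 / 2) hu
  have h := Convex.norm_image_sub_le_of_norm_hasDerivWithin_le (f := fun u : ℝ => u ^ (-a))
    (f' := fun u : ℝ => -a * u ^ (-a - 1)) (s := Ici (1 / 2 : ℝ)) (x := 1) (y := t)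
    (C := a * 2 ^ (a + 1))
    (fun u hu => (Real.hasDerivAt_rpow_const (Or.inl (hpos u hu).ne')).hasDerivWithinAt)
    (fun u hu => by
      rw [norm_mul, norm_neg, Real.norm_of_nonneg ha,
        Real.norm_of_nonneg (Real.rpow_nonneg (hpos u hu).le _)]
      gcongr
      calc u ^ (-a - 1) ≤ (1 / 2 : ℝ) ^ (-a - 1) :=
            Real.rpow_le_rpow_of_nonpos (by norm_num) hu (by linarith)
        _ = _ := by
          rw [one_div, Real.inv_rpow (by norm_num), ← Real.rpow_neg (by norm_num)]
          ring_nf)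
    (convex_Ici _) (by norm_num : (1 : ℝ) ∈ Ici (1 / 2 : ℝ)) ht
  simpa using h

/-- Regularity of the kernel in its first variable at a point `x₀` where `g` is Hölder. -/
theorem HasKernelExpansion.exists_abs_sub_le {d q ε σ : ℝ} (hdn : d < n) (hε : 0 < ε)
    (hq : 1 ≤ q) (hdq : (d - n) * q = -n) {Ω : Set 𝔼} (hΩ : Bornology.IsBounded Ω)
    {K : 𝔼 → 𝔼 → EReal} {g : 𝔼 → 𝔼 → ℝ} (hK : HasKernelExpansion Ω K g d ε)
    (hgb : ∃ M : ℝ, ∀ x ∈ Ω, ∀ ω ∈ Metric.sphere (0 : 𝔼) 1, |g x ω| ≤ M) {x₀ : 𝔼} (hx₀ : x₀ ∈ Ω)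
    (hσ : 0 < σ) (hσ1 : σ ≤ 1) {C₁ C₂ δ : ℝ}
    (hg : ∀ x ∈ Ω, ‖x - x₀‖ ≤ δ → ∀ ω ∈ Metric.sphere (0 : 𝔼) 1,
      |g x ω - g x₀ ω| ≤ C₁ * ‖x - x₀‖ ^ σ)
    (hg₀ : ∀ ω ∈ Metric.sphere (0 : 𝔼) 1, ∀ ω' ∈ Metric.sphere (0 : 𝔼) 1,
      |g x₀ ω - g x₀ ω'| ≤ C₂ * ‖ω - ω'‖ ^ σ) :
    ∃ c : ℝ, 0 < c ∧ ∀ r : ℝ, 0 < r → r ≤ δ → ∀ x ∈ Ω, ‖x - x₀‖ ≤ r / 2 → ∀ y ∈ Ω,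
      r ≤ ‖y - x₀‖ → |(K x y).toReal - (K x₀ y).toReal| ≤
        c * (‖y - x₀‖ ^ (d - n + ε) + r ^ σ * ‖y - x₀‖ ^ (d - n - σ)) := by
  obtain ⟨c, hc, hb⟩ := hK.exists_bounds hΩ hε hq hdq hgb
  obtain ⟨M', hM'⟩ := hgb
  obtain ⟨R, hR⟩ := hΩ.exists_norm_le
  set M := max M' 0 with hM
  set R₁ := 2 * max R 1 with hR₁
  set D₁ := max C₁ 0 with hD₁
  set D₂ := max C₂ 0 with hD₂
  have hM0 : 0 ≤ M := le_max_right _ _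
  have hD₁0 : 0 ≤ D₁ := le_max_right _ _
  have hD₂0 : 0 ≤ D₂ := le_max_right _ _
  have hR₁0 : 0 < R₁ := by positivity
  set a : ℝ := n - d with ha
  have ha0 : 0 < a := by linarith
  have hda : d - n = -a := by linarith
  set c₁ := c * (2 ^ a * 2 ^ ε + 1) with hc₁
  set c₂ := D₁ * R₁ ^ σ * 2 ^ a + D₂ * 2 ^ a + M * (a * 2 ^ (a + 1)) with hc₂
  have hc₁0 : 0 < c₁ := by positivity
  have hc₂0 : 0 ≤ c₂ := by positivity
  refine ⟨c₁ + c₂, by positivity, fun r hr hrδ x hx hxr y hy hyr => ?_⟩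
  set s := ‖y - x₀‖ with hs
  set s' := ‖y - x‖ with hs'
  set e := ‖x - x₀‖ with he
  have he0 : 0 ≤ e := norm_nonneg _
  have hs0 : 0 < s := hr.trans_le hyr
  have hss' : |s' - s| ≤ e := by
    have h1 := abs_norm_sub_norm_le (y - x) (y - x₀)
    rwa [sub_sub_sub_cancel_left, norm_sub_rev x₀ x] at h1
  obtain ⟨hss1, hss2⟩ := abs_le.1 hss'
  have hs'1 : s / 2 ≤ s' := by linarith
  have hs'2 : s' ≤ 2 * s := by linarith
  have hs'0 : 0 < s' := by linarith
  have hsR : s ≤ R₁ := by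
    have := norm_sub_le y x₀
    have := hR x₀ hx₀
    have := hR y hy
    have := le_max_left R 1
    linarith
  have hyx : y - x ≠ 0 := norm_pos_iff.1 hs'0
  have hyx₀ : y - x₀ ≠ 0 := norm_pos_iff.1 hs0
  have hxy : x ≠ y := (sub_ne_zero.1 hyx).symm
  have hx₀y : x₀ ≠ y := (sub_ne_zero.1 hyx₀).symm
  have hωS := norm_inv_smul_mem_sphere hx₀y
  have hω'S := norm_inv_smul_mem_sphere hxy
  have hωω := norm_inv_norm_smul_sub_le hyx hyx₀
  rw [sub_sub_sub_cancel_left, norm_sub_rev x₀ x] at hωω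
  set ω := s⁻¹ • (y - x₀) with hω
  set ω' := s'⁻¹ • (y - x) with hω'
  have hk := (hb x hx y hy hxy).2.2.2
  have hk₀ := (hb x₀ hx₀ y hy hx₀y).2.2.2
  set b := s ^ (d - n) with hbdef
  set b' := s' ^ (d - n) with hb'def
  have hb0 : 0 < b := by positivity
  have hb'0 : 0 < b' := by positivity
  rw [Real.rpow_add hs'0] at hk
  rw [Real.rpow_add hs0] at hk₀ ⊢
  have hb'b : b' ≤ 2 ^ a * b := by
    calc b' ≤ (s / 2) ^ (d - n) :=
          Real.rpow_le_rpow_of_nonpos (by positivity) hs'1 (by linarith)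
      _ = 2 ^ a * b := by
          rw [Real.div_rpow hs0.le (by norm_num), hda, Real.rpow_neg (by norm_num : (0 : ℝ) ≤ 2),
            div_inv_eq_mul, mul_comm, hbdef, hda]
  set ρ := (r / s) ^ σ with hρ
  have hρ0 : 0 ≤ ρ := by positivity
  have hρb : r ^ σ * s ^ (d - n - σ) = ρ * b := by
    rw [hρ, Real.div_rpow hr.le hs0.le, Real.rpow_sub hs0]
    ring
  have hrs : r / s ≤ 1 := (div_le_one hs0).2 hyr
  have t1 : c * (b' * s' ^ ε) ≤ c * (2 ^ a * 2 ^ ε) * (b * s ^ ε) := by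
    have h1 : s' ^ ε ≤ 2 ^ ε * s ^ ε := by
      rw [← Real.mul_rpow (by norm_num) hs0.le]
      gcongr
    calc c * (b' * s' ^ ε) ≤ c * ((2 ^ a * b) * (2 ^ ε * s ^ ε)) := by gcongr
      _ = _ := by ring
  have t2 : |g x ω' - g x₀ ω'| * b' ≤ D₁ * R₁ ^ σ * 2 ^ a * (ρ * b) := by
    -- The loss of (R₁/s)^σ ≥ 1 is deliberate: it brings this term to the common form ρ b.
    have h1 : e ^ σ ≤ R₁ ^ σ * ρ := by
      rw [hρ, ← Real.mul_rpow hR₁0.le (by positivity)]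
      refine Real.rpow_le_rpow he0 ?_ hσ.le
      rw [← mul_div_assoc, le_div_iff₀ hs0]
      have : e * s ≤ r * R₁ := by
        refine mul_le_mul (by linarith) hsR hs0.le hr.le
      linarith
    calc |g x ω' - g x₀ ω'| * b' ≤ (D₁ * (R₁ ^ σ * ρ)) * (2 ^ a * b) := by
          gcongr
          refine (hg x hx (by linarith) ω' hω'S).trans ?_
          have h2 : C₁ ≤ D₁ := le_max_left _ _
          gcongr
      _ = _ := by ring
  have t3 : |g x₀ ω' - g x₀ ω| * b' ≤ D₂ * 2 ^ a * (ρ * b) := by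
    calc |g x₀ ω' - g x₀ ω| * b' ≤ (D₂ * ρ) * (2 ^ a * b) := by
          gcongr
          refine (hg₀ ω' hω'S ω hωS).trans ?_
          have h2 : C₂ ≤ D₂ := le_max_left _ _
          have h3 : ‖ω' - ω‖ ≤ r / s := hωω.trans (by gcongr; linarith)
          rw [hρ]
          gcongr
      _ = _ := by ring
  have t4 : |g x₀ ω| * |b' - b| ≤ M * (a * 2 ^ (a + 1)) * (ρ * b) := by
    have h1 : |b' - b| ≤ (a * 2 ^ (a + 1) * ρ) * b := by
      have h2 : b' = (s' / s) ^ (-a) * b := by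
        rw [Real.div_rpow hs'0.le hs0.le, ← hda, div_mul_cancel₀ _ hb0.ne']
      have h3 := abs_rpow_neg_sub_one_le (a := a) (t := s' / s) ha0.le (by
        rw [le_div_iff₀ hs0]; linarith)
      have h4 : |s' / s - 1| ≤ ρ := by
        calc |s' / s - 1| = |s' - s| / s := by
              rw [← abs_of_pos hs0, ← abs_div, abs_of_pos hs0, sub_div, div_self hs0.ne']
          _ ≤ r / s := by gcongr; linarith
          _ = (r / s) ^ (1 : ℝ) := (Real.rpow_one _).symm
          -- The power of the distance is Lipschitz; since r/s ≤ 1 and σ ≤ 1 this is weakened to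
          -- order σ.
          _ ≤ ρ := Real.rpow_le_rpow_of_exponent_ge (by positivity) hrs hσ1
      calc |b' - b| = |(s' / s) ^ (-a) - 1| * b := by
            rw [← abs_of_pos hb0, ← abs_mul, abs_of_pos hb0, sub_mul, one_mul, ← h2]
        _ ≤ (a * 2 ^ (a + 1) * ρ) * b := by
            gcongr
            exact h3.trans (by gcongr)
    calc |g x₀ ω| * |b' - b| ≤ M * ((a * 2 ^ (a + 1) * ρ) * b) := by
          gcongr
          exact (hM' x₀ hx₀ ω hωS).trans (le_max_left _ _)
      _ = _ := by ring
  have t5 : |g x ω' * b' - g x₀ ω * b| ≤ c₂ * (ρ * b) := by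
    -- Change in turn the base point of g, the direction, and the distance.
    have h1 : g x ω' * b' - g x₀ ω * b =
        (g x ω' - g x₀ ω') * b' + (g x₀ ω' - g x₀ ω) * b' + g x₀ ω * (b' - b) := by ring
    rw [h1]
    refine (abs_add_three _ _ _).trans ?_
    rw [abs_mul, abs_mul, abs_mul, abs_of_pos hb'0, hc₂]
    linarith
  have t6 : |(K x y).toReal - (K x₀ y).toReal| ≤
      c * (b' * s' ^ ε) + c * (b * s ^ ε) + c₂ * (ρ * b) := by
    have h1 : (K x y).toReal - (K x₀ y).toReal = ((K x y).toReal - g x ω' * b') +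
        (g x₀ ω * b - (K x₀ y).toReal) + (g x ω' * b' - g x₀ ω * b) := by ring
    rw [h1]
    refine (abs_add_three _ _ _).trans ?_
    rw [abs_sub_comm (g x₀ ω * b)]
    exact add_le_add (add_le_add hk hk₀) t5
  rw [hρb]
  have h7 : 0 ≤ b * s ^ ε := by positivity
  have h8 : 0 ≤ ρ * b := by positivity
  have h9 : 0 ≤ c₂ * (b * s ^ ε) := by positivity
  have h10 : 0 ≤ c₁ * (ρ * b) := by positivity
  have h11 : c₁ * (b * s ^ ε) = c * (2 ^ a * 2 ^ ε) * (b * s ^ ε) + c * (b * s ^ ε) := by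
    rw [hc₁]; ring
  linarith

theorem abs_mul_abs_rpow_sub_two {q : ℝ} (hq : 1 < q) (t : ℝ) :
    |t * |t| ^ (q - 2)| = |t| ^ (q - 1) := by
  rw [abs_mul, abs_of_nonneg (Real.rpow_nonneg (abs_nonneg t) _)]
  rcases eq_or_ne t 0 with rfl | ht
  · rw [abs_zero, zero_mul, Real.zero_rpow (by linarith)]
  · rw [← Real.rpow_one_add' (abs_nonneg t) (by linarith)]
    ring_nf

theorem mul_mul_abs_rpow_sub_two {q : ℝ} (hq : 1 < q) (t : ℝ) :
    t * (t * |t| ^ (q - 2)) = |t| ^ q := by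
  rcases eq_or_ne t 0 with rfl | ht
  · rw [abs_zero, zero_mul, Real.zero_rpow (by linarith)]
  · rw [← mul_assoc, ← abs_mul_abs_self t, mul_assoc,
      ← Real.rpow_one_add' (abs_nonneg t) (by linarith),
      ← Real.rpow_one_add' (abs_nonneg t) (by linarith)]
    ring_nf

/-- Asymptotics of the norms and potentials of the truncated kernels as the radius shrinks. -/
theorem HasKernelExpansion.exists_truncatedKernel_bounds {d p q ε σ : ℝ} (hd : 0 < d) (hdn : d < n)
    (hpq : p.HolderConjugate q) (hdq : (d - n) * q = -n) (hε : 0 < ε) {Ω : Set 𝔼}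
    (hΩm : MeasurableSet Ω) (hΩ : Bornology.IsBounded Ω)
    {K : 𝔼 → 𝔼 → EReal} (hKs : ∀ x ∈ Ω, AEMeasurable (K x) (volume.restrict Ω))
    {g : 𝔼 → 𝔼 → ℝ} (hK : HasKernelExpansion Ω K g d ε)
    (hgs : ∀ x ∈ Ω, AEMeasurable (fun ω : Metric.sphere (0 : 𝔼) 1 => g x ω)
      (volume : Measure 𝔼).toSphere)
    (hgb : ∃ M : ℝ, ∀ x ∈ Ω, ∀ ω ∈ Metric.sphere (0 : 𝔼) 1, |g x ω| ≤ M) {x₀ : 𝔼} (hx₀ : x₀ ∈ Ω)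
    (hσ : 0 < σ) (hσ1 : σ ≤ 1) {C₁ C₂ δ : ℝ}
    (hg : ∀ x ∈ Ω, ‖x - x₀‖ ≤ δ → ∀ ω ∈ Metric.sphere (0 : 𝔼) 1,
      |g x ω - g x₀ ω| ≤ C₁ * ‖x - x₀‖ ^ σ)
    (hg₀ : ∀ ω ∈ Metric.sphere (0 : 𝔼) 1, ∀ ω' ∈ Metric.sphere (0 : 𝔼) 1,
      |g x₀ ω - g x₀ ω'| ≤ C₂ * ‖ω - ω'‖ ^ σ) {R₀ : ℝ} (hR₀ : 0 < R₀)
    (hR₀Ω : Metric.ball x₀ R₀ ⊆ Ω) :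
    ∃ c : ℝ, 0 < c ∧ ∀ r : ℝ, 0 < r → r ≤ δ → r ≤ R₀ →
      MemLp (truncatedKernel Ω K q x₀ r) (ENNReal.ofReal p) (volume.restrict Ω) ∧
      ∃ I : ℝ, lpNormOn Ω p (truncatedKernel Ω K q x₀ r) = I ^ (1 / p) ∧
        sphericalIntegral g q x₀ * Real.log (R₀ / r) ≤ I + c ∧
        ∀ x ∈ Ω, ‖x - x₀‖ ≤ r / 2 → I - c ≤ potential Ω K (truncatedKernel Ω K q x₀ r) x := by
  have hp := hpq.pos
  have hq := hpq.symm.pos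
  have hq1 := hpq.symm.lt
  have hn' : (0 : ℝ) < n := hd.trans hdn
  have hn : 0 < n := by exact_mod_cast hn'
  have hpq' : (q - 1) * p = q := by
    have := hpq.sub_one_mul_conj
    have := hpq.mul_eq_add
    linarith
  have hdd : (d - n) * (q - 1) = -d := by linarith
  have : IsFiniteMeasure ((volume : Measure 𝔼).restrict Ω) :=
    isFiniteMeasure_restrict.2 hΩ.measure_lt_top.ne
  obtain ⟨c, hc, hb⟩ := hK.exists_bounds hΩ hε hq1.le hdq hgb
  obtain ⟨c', hc', hb'⟩ := hK.exists_abs_sub_le hdn hε hq1.le hdq hΩ hgb hx₀ hσ hσ1 hg hg₀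
  obtain ⟨N, hN⟩ := hΩ.exists_norm_le
  set R₁ := 2 * max N 1 + 1 with hR₁
  have hR₁0 : 0 < R₁ := by positivity
  have hΩR : Ω ⊆ Metric.ball x₀ R₁ := fun y hy => by
    rw [mem_ball_iff_norm]
    have := norm_sub_le y x₀
    have := hN x₀ hx₀
    have := hN y hy
    have := le_max_left N 1
    linarith
  have hS : 0 ≤ sphereArea n := sphereArea_nonneg
  set ν := (volume : Measure 𝔼).restrict Ω with hν
  have hνΩ : ∀ᵐ y ∂ν, y ∈ Ω := ae_restrict_mem hΩm
  set c₁ := c' * c ^ (q - 1) with hc₁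
  have hc₁0 : 0 < c₁ := by positivity
  set c₂ := c₁ * (sphereArea n * (R₁ ^ ε / ε)) + c₁ * (sphereArea n * (1 / σ)) with hc₂
  set c₃ := c * (sphereArea n * (R₀ ^ ε / ε)) with hc₃
  have hc₂0 : 0 ≤ c₂ := by positivity
  have hc₃0 : 0 ≤ c₃ := by positivity
  refine ⟨c₂ + c₃ + 1, by positivity, fun r hr hrδ hrR₀ => ?_⟩
  set Φ := truncatedKernel Ω K q x₀ r with hΦ
  set κ₀ : 𝔼 → ℝ := fun y => (K x₀ y).toReal with hκ₀
  set D := Ω \ Metric.ball x₀ r with hD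
  have hDm : MeasurableSet D := hΩm.diff measurableSet_ball
  have hDr : ∀ y ∈ D, r ≤ ‖y - x₀‖ := fun y hy => by simpa [dist_eq_norm] using hy.2
  have hDne : ∀ y ∈ D, x₀ ≠ y := fun y hy h => by
    have := hDr y hy
    rw [h, sub_self, norm_zero] at this
    linarith
  have hκm : ∀ x ∈ Ω, AEMeasurable (fun y => (K x y).toReal) ν := fun x hx =>
    measurable_ereal_toReal.comp_aemeasurable (hKs x hx)
  have hκ₀m : AEMeasurable κ₀ ν := hκm x₀ hx₀
  have hΦm : AEMeasurable Φ ν :=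
    (hκ₀m.mul ((continuous_abs.measurable.comp_aemeasurable hκ₀m).pow_const _)).indicator hDm
  have hΦD : ∀ y ∈ D, Φ y = κ₀ y * |κ₀ y| ^ (q - 2) := fun y hy => indicator_of_mem hy _
  have hΦD' : ∀ y, y ∉ D → Φ y = 0 := fun y hy => indicator_of_notMem hy _
  have hΦabs : ∀ y ∈ D, |Φ y| = |κ₀ y| ^ (q - 1) := fun y hy => by
    rw [hΦD y hy, abs_mul_abs_rpow_sub_two hq1]
  have hΦle : ∀ y ∈ D, |Φ y| ≤ c ^ (q - 1) * ‖y - x₀‖ ^ (-d) := fun y hy => by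
    rw [hΦabs y hy, ← hdd, Real.rpow_mul (norm_nonneg _), ← Real.mul_rpow hc.le (by positivity)]
    exact Real.rpow_le_rpow (abs_nonneg _) (hb x₀ hx₀ y hy.1 (hDne y hy)).1 (by linarith)
  have hΦbd : ∀ y, |Φ y| ≤ c ^ (q - 1) * r ^ (-d) := fun y => by
    by_cases hy : y ∈ D
    · refine (hΦle y hy).trans ?_
      gcongr ?_ * ?_
      exact Real.rpow_le_rpow_of_nonpos hr (hDr y hy) (by linarith)
    · rw [hΦD' y hy, abs_zero]; positivity
  have hmem : MemLp Φ (ENNReal.ofReal p) ν :=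
    MemLp.of_bound hΦm.aestronglyMeasurable _ (.of_forall hΦbd)
  set J : ℝ≥0∞ := ∫⁻ y in D, ENNReal.ofReal (|κ₀ y| ^ q) ∂ν with hJ
  have hJΦ : ∫⁻ y, ‖Φ y‖ₑ ^ p ∂ν = J := by
    rw [hJ, ← lintegral_indicator hDm]
    refine lintegral_congr fun y => ?_
    by_cases hy : y ∈ D
    · rw [indicator_of_mem hy, Real.enorm_eq_ofReal_abs, hΦabs y hy,
        ENNReal.ofReal_rpow_of_nonneg (by positivity) hp.le, ← Real.rpow_mul (abs_nonneg _), hpq']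
    · rw [indicator_of_notMem hy, hΦD' y hy, enorm_zero, ENNReal.zero_rpow_of_pos hp]
  have hLJ : eLpNorm Φ (ENNReal.ofReal p) ν = J ^ (1 / p) := by
    rw [eLpNorm_eq_lintegral_rpow_enorm_toReal (by simpa using hp) ENNReal.ofReal_ne_top,
      ENNReal.toReal_ofReal hp.le, hJΦ]
  have hJt : J ≠ ⊤ := fun h => by
    have := hmem.2.ne
    rw [hLJ, h, ENNReal.top_rpow_of_pos (by positivity)] at this
    exact this rfl
  -- Equality in Hölder at x₀: on D, K(x₀,·)Φ = |K(x₀,·)|^q = |Φ|^p, because (q - 1)p = q.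
  have hpot₀ : ∫ y, κ₀ y * Φ y ∂ν = J.toReal := by
    have h1 := integral_eq_lintegral_of_nonneg_ae (μ := ν.restrict D) (f := fun y => |κ₀ y| ^ q)
      (.of_forall fun y => Real.rpow_nonneg (abs_nonneg _) _)
      ((continuous_abs.measurable.comp_aemeasurable hκ₀m).pow_const q).aestronglyMeasurable.restrict
    rw [hJ, ← h1, ← integral_indicator hDm]
    congr 1
    ext y
    by_cases hy : y ∈ D
    · rw [indicator_of_mem hy, hΦD y hy, mul_mul_abs_rpow_sub_two hq1]
    · rw [indicator_of_notMem hy, hΦD' y hy, mul_zero]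
  have hint : ∀ x ∈ Ω, ‖x - x₀‖ ≤ r / 2 → Integrable (fun y => (K x y).toReal * Φ y) ν := by
    intro x hx hxr
    refine Integrable.of_bound (C := c * (r / 2) ^ (d - n) * (c ^ (q - 1) * r ^ (-d)))
      ((hκm x hx).mul hΦm).aestronglyMeasurable ?_
    filter_upwards [hνΩ] with y hy
    rw [norm_mul, Real.norm_eq_abs, Real.norm_eq_abs]
    by_cases hyD : y ∈ D
    · have h1 : r / 2 ≤ ‖y - x‖ := by
        have h2 := norm_sub_le_norm_sub_add_norm_sub y x x₀
        have := hDr y hyD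
        linarith
      have hxy : x ≠ y := fun h => by
        rw [h, sub_self, norm_zero] at h1
        linarith
      gcongr
      · refine (hb x hx y hy hxy).1.trans ?_
        gcongr ?_ * ?_
        exact Real.rpow_le_rpow_of_nonpos (by positivity) h1 (by linarith)
      · exact hΦbd y
    · rw [hΦD' y hyD, abs_zero, mul_zero]; positivity
  refine ⟨hmem, J.toReal, ?_, ?_, fun x hx hxr => ?_⟩
  · rw [lpNormOn, hLJ, ENNReal.toReal_rpow]
  · set G₀ : 𝔼 → ℝ≥0∞ := fun ω => ENNReal.ofReal (|g x₀ ω| ^ q) with hG₀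
    have hG₀m : AEMeasurable (fun ω : Metric.sphere (0 : 𝔼) 1 => G₀ ω)
        (volume : Measure 𝔼).toSphere :=
      ((continuous_abs.measurable.comp_aemeasurable (hgs x₀ hx₀)).pow_const q).ennreal_ofReal
    obtain ⟨M, hM⟩ := hgb
    have hann := lintegral_annulus hn x₀ hr hrR₀ hG₀m
    rw [← ofReal_sphericalIntegral hq.le (hgs x₀ hx₀) (hM x₀ hx₀),
      ← ENNReal.ofReal_mul (sphericalIntegral_nonneg g q x₀)] at hann
    have hsub : Metric.ball x₀ R₀ \ Metric.ball x₀ r ⊆ D := sdiff_subset_sdiff_left hR₀Ω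
    have hAm : MeasurableSet (Metric.ball x₀ R₀ \ Metric.ball x₀ r) :=
      measurableSet_ball.diff measurableSet_ball
    have hνA : (volume : Measure 𝔼).restrict (Metric.ball x₀ R₀ \ Metric.ball x₀ r) =
        ν.restrict (Metric.ball x₀ R₀ \ Metric.ball x₀ r) := by
      rw [hν, Measure.restrict_restrict hAm, inter_eq_left.2 (hsub.trans sdiff_subset)]
    have hle : ENNReal.ofReal (sphericalIntegral g q x₀ * Real.log (R₀ / r)) ≤
        J + ENNReal.ofReal c₃ := by
      rw [← hann, hνA]
      calc ∫⁻ y in Metric.ball x₀ R₀ \ Metric.ball x₀ r,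
            ENNReal.ofReal (‖y - x₀‖ ^ (-n : ℝ)) * G₀ (‖y - x₀‖⁻¹ • (y - x₀)) ∂ν
          ≤ ∫⁻ y in Metric.ball x₀ R₀ \ Metric.ball x₀ r, (ENNReal.ofReal (|κ₀ y| ^ q) +
              ENNReal.ofReal (c * ‖y - x₀‖ ^ (ε - n))) ∂ν := by
            refine setLIntegral_mono' hAm fun y hy => ?_
            simp only [hG₀]
            rw [← ENNReal.ofReal_mul (by positivity),
              ← ENNReal.ofReal_add (by positivity) (by positivity)]
            exact ENNReal.ofReal_le_ofReal
              (hb x₀ hx₀ y (hsub hy).1 (hDne y (hsub hy))).2.2.1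
        _ = (∫⁻ y in Metric.ball x₀ R₀ \ Metric.ball x₀ r, ENNReal.ofReal (|κ₀ y| ^ q) ∂ν) +
              ∫⁻ y in Metric.ball x₀ R₀ \ Metric.ball x₀ r,
                ENNReal.ofReal (c * ‖y - x₀‖ ^ (ε - n)) ∂ν :=
            lintegral_add_right _ (by fun_prop)
        _ ≤ _ := by
            refine add_le_add (lintegral_mono_set hsub) ((lintegral_mono_set sdiff_subset).trans ?_)
            exact setLIntegral_ball_le_of_le_rpow hn hΩm hε hc.le hR₀.le fun y _ _ => le_rfl
    rw [← ENNReal.ofReal_toReal hJt, ← ENNReal.ofReal_add ENNReal.toReal_nonneg hc₃0,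
      ENNReal.ofReal_le_ofReal_iff (by positivity)] at hle
    linarith
  · have h1 : potential Ω K Φ x - J.toReal = ∫ y, ((K x y).toReal - κ₀ y) * Φ y ∂ν := by
      rw [potential, ← hpot₀, ← integral_sub (hint x hx hxr)
        (hint x₀ hx₀ (by rw [sub_self, norm_zero]; positivity))]
      congr 1
      ext y
      ring
    -- With |Φ| ≲ s^{-d} at s = |y-x₀|, the integrand is O(s^{ε-n} + r^σ s^{-σ-n}). The first part
    -- is integrable on Ω; the second, over s ≥ r, scales to a multiple of 1/σ. Hence the bound is
    -- uniform in r.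
    have h2 : ‖∫ y, ((K x y).toReal - κ₀ y) * Φ y ∂ν‖ₑ ≤ ENNReal.ofReal c₂ := by
      refine (enorm_integral_le_lintegral_enorm _).trans ?_
      calc ∫⁻ y, ‖((K x y).toReal - κ₀ y) * Φ y‖ₑ ∂ν
          ≤ ∫⁻ y, (ENNReal.ofReal (c₁ * ‖y - x₀‖ ^ (ε - n)) +
              (Metric.ball x₀ r)ᶜ.indicator (fun y => ENNReal.ofReal (c₁ * r ^ σ) *
                ENNReal.ofReal (‖y - x₀‖ ^ (-σ - n))) y) ∂ν := by
            refine lintegral_mono_ae ?_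
            filter_upwards [hνΩ] with y hy
            by_cases hyD : y ∈ D
            · have hs0 : 0 < ‖y - x₀‖ := hr.trans_le (hDr y hyD)
              rw [indicator_of_mem hyD.2, Real.enorm_eq_ofReal_abs,
                ← ENNReal.ofReal_mul (by positivity),
                ← ENNReal.ofReal_add (by positivity) (by positivity), abs_mul]
              refine ENNReal.ofReal_le_ofReal ?_
              have e1 : ‖y - x₀‖ ^ (d - n + ε) * ‖y - x₀‖ ^ (-d) = ‖y - x₀‖ ^ (ε - n) := by
                rw [← Real.rpow_add hs0]; ring_nf
              have e2 : ‖y - x₀‖ ^ (d - n - σ) * ‖y - x₀‖ ^ (-d) = ‖y - x₀‖ ^ (-σ - n) := by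
                rw [← Real.rpow_add hs0]; ring_nf
              calc |(K x y).toReal - κ₀ y| * |Φ y|
                  ≤ (c' * (‖y - x₀‖ ^ (d - n + ε) + r ^ σ * ‖y - x₀‖ ^ (d - n - σ))) *
                    (c ^ (q - 1) * ‖y - x₀‖ ^ (-d)) := by
                    gcongr
                    · exact hb' r hr hrδ x hx hxr y hy (hDr y hyD)
                    · exact hΦle y hyD
                _ = c₁ * (‖y - x₀‖ ^ (d - n + ε) * ‖y - x₀‖ ^ (-d)) +
                    c₁ * r ^ σ * (‖y - x₀‖ ^ (d - n - σ) * ‖y - x₀‖ ^ (-d)) := by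
                    rw [hc₁]; ring
                _ = _ := by rw [e1, e2]
            · rw [hΦD' y hyD, mul_zero, enorm_zero]
              exact zero_le
        _ = (∫⁻ y, ENNReal.ofReal (c₁ * ‖y - x₀‖ ^ (ε - n)) ∂ν) +
              ∫⁻ y in (Metric.ball x₀ r)ᶜ, ENNReal.ofReal (c₁ * r ^ σ) *
                ENNReal.ofReal (‖y - x₀‖ ^ (-σ - n)) ∂ν := by
            rw [lintegral_add_left (by fun_prop), lintegral_indicator measurableSet_ball.compl]
        _ ≤ ENNReal.ofReal (c₁ * (sphereArea n * (R₁ ^ ε / ε))) +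
              ENNReal.ofReal (c₁ * (sphereArea n * (1 / σ))) := by
            refine add_le_add ?_ ?_
            · rw [← Measure.restrict_eq_self_of_ae_mem (hνΩ.mono hΩR)]
              exact setLIntegral_ball_le_of_le_rpow hn hΩm hε hc₁0.le hR₁0.le fun y _ _ => le_rfl
            · refine (lintegral_mono' (Measure.restrict_mono_measure
                Measure.restrict_le_self _) le_rfl).trans_eq ?_
              rw [lintegral_const_mul _ (by fun_prop), lintegral_compl_ball_rpow hn x₀ hr hσ,
                ← ofReal_sphereArea, ← ENNReal.ofReal_mul hS, ← ENNReal.ofReal_mul (by positivity)]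
              congr 1
              have e3 : r ^ σ * r ^ (-σ) = 1 := by
                rw [← Real.rpow_add hr, add_neg_cancel, Real.rpow_zero]
              calc c₁ * r ^ σ * (sphereArea n * (r ^ (-σ) / σ))
                  = c₁ * (sphereArea n * ((r ^ σ * r ^ (-σ)) / σ)) := by ring
                _ = _ := by rw [e3]
        _ = _ := by rw [← ENNReal.ofReal_add (by positivity) (by positivity)]
    rw [Real.enorm_eq_ofReal_abs, ENNReal.ofReal_le_ofReal_iff hc₂0, ← h1] at h2
    have := (abs_le.1 h2).1
    linarith

/-- Since q/p = q - 1, the right side is at least I(1 - c/I)^q, and Bernoulli's inequality gives I -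
qc: a bounded loss in T costs only a bounded loss in the exponent. -/
theorem sub_mul_le_div_rpow {p q I T c : ℝ} (hpq : p.HolderConjugate q) (hc : 0 ≤ c) (hcI : c < I)
    (hT : I - c ≤ T) : I - q * c ≤ (|T| / I ^ (1 / p)) ^ q := by
  have hq := hpq.symm.pos
  have hI : 0 < I := hc.trans_lt hcI
  have h1 : 1 + q * (-(c / I)) ≤ (1 + -(c / I)) ^ q :=
    one_add_mul_self_le_rpow_one_add (by have := (div_le_one hI).2 hcI.le
                                         linarith) hpq.symm.lt.le
  have h2 : (I ^ (1 / p)) ^ q * I = I ^ q := by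
    rw [← Real.rpow_mul hI.le, ← Real.rpow_add_one hI.ne', one_div_mul_eq_div]
    congr 1
    have := hpq.symm.div_conj_eq_sub_one
    linarith
  have hIp : 0 < (I ^ (1 / p)) ^ q := by positivity
  calc I - q * c = I * (1 + q * (-(c / I))) := by field_simp; ring
    _ ≤ I * (1 + -(c / I)) ^ q := by gcongr
    _ = (I - c) ^ q / (I ^ (1 / p)) ^ q := by
        have h3 : 1 + -(c / I) = (I - c) / I := by field_simp; ring
        rw [h3, Real.div_rpow (by linarith) hI.le, ← h2]
        field_simp
    _ ≤ |T| ^ q / (I ^ (1 / p)) ^ q := by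
        gcongr
        exact hT.trans (le_abs_self T)
    _ = _ := (Real.div_rpow (abs_nonneg _) (by positivity) _).symm

theorem tendsto_expIntegral_truncatedKernel {p q α A c R₀ : ℝ} (hn : 0 < n)
    (hpq : p.HolderConjugate q) (hA : 0 < A) (hα : A⁻¹ < α) (hc : 0 < c) (hR₀ : 0 < R₀)
    {Ω : Set 𝔼} {K : 𝔼 → 𝔼 → EReal} {x₀ : 𝔼} (hR₀Ω : Metric.ball x₀ R₀ ⊆ Ω) {r : ℕ → ℝ}
    (hr : ∀ m, 0 < r m) (hrR : ∀ m, r m ≤ R₀) (hr0 : Tendsto r atTop (𝓝 0))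
    (h : ∀ m, ∃ I : ℝ, lpNormOn Ω p (truncatedKernel Ω K q x₀ (r m)) = I ^ (1 / p) ∧
      n * A * Real.log (R₀ / r m) ≤ I + c ∧
      ∀ x ∈ Ω, ‖x - x₀‖ ≤ r m / 2 →
        I - c ≤ potential Ω K (truncatedKernel Ω K q x₀ (r m)) x) :
    Tendsto (fun m => expIntegral Ω K p q α (truncatedKernel Ω K q x₀ (r m))) atTop (𝓝 ⊤) := by
  have : Nonempty (Fin n) := ⟨⟨0, hn⟩⟩
  have hn' : (0 : ℝ) < n := by exact_mod_cast hn
  have hα0 : 0 < α := (inv_pos.2 hA).trans hα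
  have hq := hpq.symm.pos
  have hL : Tendsto (fun m => Real.log (R₀ / r m)) atTop atTop := by
    have h1 : Tendsto r atTop (𝓝[>] 0) :=
      tendsto_nhdsWithin_iff.2 ⟨hr0, .of_forall fun m => hr m⟩
    exact Real.tendsto_log_atTop.comp (h1.inv_tendsto_nhdsGT_zero.const_mul_atTop hR₀)
  set V := (volume : Measure 𝔼).real (Metric.ball 0 1) with hV
  have hV0 : 0 < V := ENNReal.toReal_pos (Metric.measure_ball_pos _ _ one_pos).ne'
    measure_ball_lt_top.ne
  -- The bounded terms: the volume of the ball of radius r/2 supplies n log(R₀/2), the lower bound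
  -- on I loses αc, and Bernoulli loses αqc.
  set b := n * Real.log (R₀ / 2) - α * ((1 + q) * c) with hb
  have hlow : Tendsto (fun m => ENNReal.ofReal
      (V * Real.exp (n * (α * A - 1) * Real.log (R₀ / r m) + b))) atTop (𝓝 ⊤) := by
    refine ENNReal.tendsto_ofReal_atTop.comp ?_
    refine (Real.tendsto_exp_atTop.comp ?_).const_mul_atTop hV0
    refine tendsto_atTop_add_const_right _ _ (hL.const_mul_atTop ?_)
    have : 1 < α * A := by rwa [inv_lt_iff_one_lt_mul₀ hA] at hα
    exact mul_pos hn' (by linarith)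
  refine tendsto_nhds_top_mono hlow ?_
  -- Beyond this threshold nA log(R₀/r) > 2c, hence I > c.
  filter_upwards [hL.eventually_gt_atTop (2 * c / (n * A))] with m hm
  obtain ⟨I, hI, hIlog, hpot⟩ := h m
  have hcI : c < I := by
    rw [div_lt_iff₀ (by positivity)] at hm
    linarith
  set L := Real.log (R₀ / r m) with hLdef
  have hrm := hr m
  have hballΩ : Metric.ball x₀ (r m / 2) ⊆ Ω :=
    (Metric.ball_subset_ball (by linarith [hrR m])).trans hR₀Ω
  calc ENNReal.ofReal (V * Real.exp (n * (α * A - 1) * L + b))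
      ≤ ENNReal.ofReal (Real.exp (α * (I - q * c))) * volume (Metric.ball x₀ (r m / 2)) := by
        rw [Measure.addHaar_ball _ _ (by positivity), finrank_euclideanSpace_fin,
          ← ENNReal.ofReal_toReal (measure_ball_lt_top (x := (0 : 𝔼)) (r := 1)).ne,
          ← ENNReal.ofReal_mul (by positivity), ← ENNReal.ofReal_mul (by positivity)]
        refine ENNReal.ofReal_le_ofReal ?_
        have h1 : (r m / 2) ^ n = Real.exp (n * (Real.log (R₀ / 2) - L)) := by
          have h2 : Real.log (R₀ / 2) - L = Real.log (r m / 2) := by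
            rw [hLdef, ← Real.log_div (by positivity) (by positivity)]
            congr 1
            field_simp
          rw [h2, Real.exp_nat_mul, Real.exp_log (by positivity)]
        rw [h1, ← mul_assoc, ← Real.exp_add, mul_comm V]
        refine mul_le_mul_of_nonneg_right (Real.exp_le_exp.2 ?_) hV0.le
        have h3 : α * (n * A * L - c) ≤ α * I := by gcongr; linarith
        rw [hb]
        linarith
    _ = ∫⁻ _ in Metric.ball x₀ (r m / 2), ENNReal.ofReal (Real.exp (α * (I - q * c))) := by
        rw [setLIntegral_const]
    _ ≤ ∫⁻ x in Metric.ball x₀ (r m / 2), ENNReal.ofReal (Real.exp (α *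
          (|potential Ω K (truncatedKernel Ω K q x₀ (r m)) x| /
            lpNormOn Ω p (truncatedKernel Ω K q x₀ (r m))) ^ q)) := by
        refine setLIntegral_mono' measurableSet_ball fun x hx => ?_
        rw [hI]
        have h4 := sub_mul_le_div_rpow hpq hc.le hcI (hpot x (hballΩ hx)
          (mem_ball_iff_norm.1 hx).le)
        gcongr
    _ ≤ _ := lintegral_mono_set hballΩ

end Euclidean

/-! ### The main theorem. -/

theorem theorem8 (n : ℕ) (d p q ε : ℝ) (hd : 0 < d) (hdn : d < n) (hp : p = n / d)
    (hpq : 1 / p + 1 / q = 1) (hε : 0 < ε)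
    (Ω : Set (EuclideanSpace ℝ (Fin n))) (hΩo : IsOpen Ω) (hΩb : Bornology.IsBounded Ω)
    (K : EuclideanSpace ℝ (Fin n) → EuclideanSpace ℝ (Fin n) → EReal)
    (hKm : AEMeasurable
      (fun z : EuclideanSpace ℝ (Fin n) × EuclideanSpace ℝ (Fin n) => K z.1 z.2)
      (volume.restrict (Ω ×ˢ Ω)))
    (hKs : ∀ x ∈ Ω, AEMeasurable (K x) (volume.restrict Ω))
    (g : EuclideanSpace ℝ (Fin n) → EuclideanSpace ℝ (Fin n) → ℝ)
    (hgm : AEMeasurable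
      (fun z : EuclideanSpace ℝ (Fin n) × Metric.sphere (0 : EuclideanSpace ℝ (Fin n)) 1 =>
        g z.1 z.2)
      ((volume.restrict Ω).prod (volume : Measure (EuclideanSpace ℝ (Fin n))).toSphere))
    (hgs : ∀ x ∈ Ω, AEMeasurable
      (fun ω : Metric.sphere (0 : EuclideanSpace ℝ (Fin n)) 1 => g x ω)
      (volume : Measure (EuclideanSpace ℝ (Fin n))).toSphere)
    (hgb : ∃ M : ℝ, ∀ x ∈ Ω, ∀ ω ∈ Metric.sphere (0 : EuclideanSpace ℝ (Fin n)) 1,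
      |g x ω| ≤ M)
    (hK : HasKernelExpansion Ω K g d ε)
    (hA : 0 < adamsA Ω g q) :
    -- `T` is well defined on `L^p(Ω)`
    (∀ f : EuclideanSpace ℝ (Fin n) → ℝ, MemLp f (ENNReal.ofReal p) (volume.restrict Ω) →
      (∀ᵐ x ∂(volume.restrict Ω),
        Integrable (fun y => (K x y).toReal * f y) (volume.restrict Ω)) ∧
      AEMeasurable (potential Ω K f) (volume.restrict Ω)) ∧
    -- the exponential inequality
    (∃ C : ℝ, 0 < C ∧ ∀ f : EuclideanSpace ℝ (Fin n) → ℝ,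
      MemLp f (ENNReal.ofReal p) (volume.restrict Ω) →
      expIntegral Ω K p q (adamsA Ω g q)⁻¹ f ≤ ENNReal.ofReal C) ∧
    -- sharpness
    (∀ x₀ ∈ Ω, adamsA Ω g q = (1 / (n : ℝ)) * sphericalIntegral g q x₀ →
      ∀ σ : ℝ, 0 < σ → σ ≤ 1 →
      (∃ C δ : ℝ, 0 < δ ∧ ∀ x ∈ Ω, ‖x - x₀‖ ≤ δ →
        ∀ ω ∈ Metric.sphere (0 : EuclideanSpace ℝ (Fin n)) 1,
          |g x ω - g x₀ ω| ≤ C * ‖x - x₀‖ ^ σ) →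
      (∃ C : ℝ, ∀ ω ∈ Metric.sphere (0 : EuclideanSpace ℝ (Fin n)) 1,
        ∀ ω' ∈ Metric.sphere (0 : EuclideanSpace ℝ (Fin n)) 1,
          |g x₀ ω - g x₀ ω'| ≤ C * ‖ω - ω'‖ ^ σ) →
      (∀ α : ℝ, (adamsA Ω g q)⁻¹ < α →
        ⨆ (f : EuclideanSpace ℝ (Fin n) → ℝ)
          (_ : MemLp f (ENNReal.ofReal p) (volume.restrict Ω)),
          expIntegral Ω K p q α f = ⊤) ∧
      ∃ r : ℕ → ℝ, Tendsto r atTop (𝓝 0) ∧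
        (∀ m, 0 < r m ∧ Metric.ball x₀ (r m) ⊆ Ω ∧
          MemLp (truncatedKernel Ω K q x₀ (r m)) (ENNReal.ofReal p) (volume.restrict Ω)) ∧
        ∀ α : ℝ, (adamsA Ω g q)⁻¹ < α →
          Tendsto (fun m => expIntegral Ω K p q α (truncatedKernel Ω K q x₀ (r m)))
            atTop (𝓝 ⊤)) := by
  have hn' : (0 : ℝ) < n := hd.trans hdn
  have hn : 0 < n := by exact_mod_cast hn'
  have hp1 : 1 < p := by rw [hp]; exact (one_lt_div hd).2 hdn
  have hpq' : p.HolderConjugate q :=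
    Real.holderConjugate_iff.2 ⟨hp1, by rwa [one_div, one_div] at hpq⟩
  have hq1 := hpq'.symm.lt
  have hdq : (d - n) * q = -n := by
    have h1 : d / n + q⁻¹ = 1 := by
      rw [← hpq, hp, one_div_div, one_div]
    have hq0 : q ≠ 0 := by linarith
    field_simp at h1
    linarith
  have hΩm : MeasurableSet Ω := hΩo.measurableSet
  have : IsFiniteMeasure ((volume : Measure (EuclideanSpace ℝ (Fin n))).restrict Ω) :=
    isFiniteMeasure_restrict.2 hΩb.measure_lt_top.ne
  obtain ⟨C, hk⟩ := hK.isAdamsKernel hd hdn hp hq1.le hdq hε hΩm hΩb hKm hgs hgb hA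
  have hκ : AEMeasurable (fun z : EuclideanSpace ℝ (Fin n) × EuclideanSpace ℝ (Fin n) =>
      (K z.1 z.2).toReal) ((volume.restrict Ω).prod (volume.restrict Ω)) := by
    rw [Measure.prod_restrict]
    exact measurable_ereal_toReal.comp_aemeasurable hKm
  refine ⟨fun f hf => ?_, ?_, fun x₀ hx₀ hAx₀ σ hσ hσ1 hg hg₀ => ?_⟩
  · have hint := hk.integrable_mul (κ := fun x y => (K x y).toReal) hκ hpq' hf
    exact ⟨hint.prod_right_ae, hint.integral_prod_left.1.aemeasurable⟩
  · exact hk.exists_lintegral_exp_abs_integral_le (κ := fun x y => (K x y).toReal)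
      (hasIntermediateSubsets_restrict hn hΩb) hκ hpq' hA
  · obtain ⟨C₁, δ, hδ, hg⟩ := hg
    obtain ⟨C₂, hg₀⟩ := hg₀
    obtain ⟨R₀, hR₀, hR₀Ω⟩ := Metric.isOpen_iff.1 hΩo x₀ hx₀
    obtain ⟨c, hc, hbd⟩ := hK.exists_truncatedKernel_bounds hd hdn hpq' hdq hε hΩm hΩb hKs hgs hgb
      hx₀ hσ hσ1 hg hg₀ hR₀ hR₀Ω
    -- Any null sequence of positive radii bounded by δ and R₀ would serve: δ keeps x in the Hölder
    -- neighbourhood, R₀ keeps the balls in Ω.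
    set r : ℕ → ℝ := fun m => min δ R₀ * (1 / ((m : ℝ) + 1)) with hr
    have hmin : 0 < min δ R₀ := lt_min hδ hR₀
    have hr0 : ∀ m, 0 < r m := fun m => by simp only [hr]; positivity
    have hrle : ∀ m, r m ≤ min δ R₀ := fun m => by
      refine mul_le_of_le_one_right hmin.le ?_
      rw [div_le_one (by positivity)]
      simp
    have hrδ : ∀ m, r m ≤ δ := fun m => (hrle m).trans (min_le_left _ _)
    have hrR : ∀ m, r m ≤ R₀ := fun m => (hrle m).trans (min_le_right _ _)
    have hrt : Tendsto r atTop (𝓝 0) := by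
      simpa only [hr, mul_zero] using (tendsto_one_div_add_atTop_nhds_zero_nat (𝕜 := ℝ)).const_mul (min δ R₀)
    have hmem := fun m => (hbd (r m) (hr0 m) (hrδ m) (hrR m)).1
    have hlim : ∀ α : ℝ, (adamsA Ω g q)⁻¹ < α →
        Tendsto (fun m => expIntegral Ω K p q α (truncatedKernel Ω K q x₀ (r m)))
          atTop (𝓝 ⊤) := fun α hα =>
      tendsto_expIntegral_truncatedKernel hn hpq' hA hα hc hR₀ hR₀Ω hr0 hrR hrt fun m => by
        obtain ⟨I, h1, h2, h3⟩ := (hbd (r m) (hr0 m) (hrδ m) (hrR m)).2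
        refine ⟨I, h1, ?_, h3⟩
        rwa [hAx₀, ← mul_assoc, mul_one_div_cancel hn'.ne', one_mul]
    refine ⟨fun α hα => top_le_iff.1 (le_of_tendsto' (hlim α hα) fun m => ?_), r, hrt,
      fun m => ⟨hr0 m, (Metric.ball_subset_ball (hrR m)).trans hR₀Ω, hmem m⟩, hlim⟩
    exact le_iSup₂_of_le (truncatedKernel Ω K q x₀ (r m)) (hmem m) le_rfl
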